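/- Let $A\in M_n(\mathbb R)$ and $B\in M_{n,m}(\mathbb R)$, where $B$ has rank $m$ and $(A,B)$ satisfies the Kalman condition $\mathrm{span}\{B,AB,\dots,A^{n-1}B\}=\mathbb R^n$. Call a triple $(Q,S,R)$ of constant matrices an admissible cost if $Q\in M_n(\mathbb R)$ is symmetric, $S\in M_{n,m}(\mathbb R)$, $R\in M_m(\mathbb R)$ is symmetric positive definite, and the Hamiltonian matrix $$\begin{pmatrix} A-BR^{-1}S^\top & BR^{-1}B^\top\\ Q-SR^{-1}S^\top & -A^\top+SR^{-1}B^\top\end{pmatrix}$$ has no eigenvalue on the imaginary axis. The pair of matrices attached to $(Q,S,R)$ is $(A_+,A_-)$, where $A_\pm=A-BR^{-1}(S^\top+B^\top P_\pm)$ and $P_\pm$ are the symmetric solutions of the algebraic Riccati equation $$PA+A^\top P-(S+PB)R^{-1}(S^\top+B^\top P)+Q=0$$ for which $A_+$ is asymptotically stable (all eigenvalues have negative real part) and $A_-$ is asymptotically anti-stable (all eigenvalues have positive real part). Let $\mathcal J$ be the set of the pairs $(A_+,A_-)\in M_n(\mathbb R)^2$ corresponding to optimal syntheses of autonomous LQ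 problems with dynamics $(A,B)$, that is, the set of the pairs attached to admissible costs. These pairs do describe the optimal syntheses: if $(A_+,A_-)$ is the pair attached to $(Q,S,R)$, then for all $t_0<t_1$ and $x_0,x_1\in\mathbb R^n$, the problem of minimizing $\int_{t_0}^{t_1}(x^\top Qx+2x^\top Su+u^\top Ru)\,dt$ over the trajectories of $\dot x=Ax+Bu$, $u\in L^2$, with $x(t_0)=x_0$ and $x(t_1)=x_1$ has a unique minimizing trajectory $x$, and there is a unique pair $(y_+,y_-)\in\mathbb R^n\times\mathbb R^n$ with $x(t)=e^{tA_+}y_++e^{tA_-}y_-$ for all $t\in[t_0,t_1]$. Moreover, $\mathcal J$ is equal to the set of pairs $(A_+,A_-)$ of the form $A_+=A-BK_+$, $A_-=A-BK_-$ with $K_\pm\in M_{m,n}(\mathbb R)$ for which there exists a symmetric positive definite $\Delta\in M_n(\mathbb R)$ such that: 1. $A_+=-\Delta^{-1}A_-^\top\Delta$; 2. $A_+$ is asymptotically stable; 3. the matrix $(B^\top B)^{-1}B^\top\left(A_+\Delta^{-1}+\Delta^{-1}A_+^\top\right)B(B^\top B)^{-1}$ is symmetric negative definite. -/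

import Mathlib

open Set MeasureTheory
open scoped Matrix

noncomputable section

namespace AutonomousLQ

variable {n m : ℕ}

/-- `A` is asymptotically stable (Hurwitz): every complex eigenvalue has negative real part. -/
def IsStable (A : Matrix (Fin n) (Fin n) ℝ) : Prop :=
  ∀ z ∈ spectrum ℂ (A.map Complex.ofReal), z.re < 0

/-- `A` is asymptotically anti-stable: every complex eigenvalue has positive real part. -/
def IsAntiStable (A : Matrix (Fin n) (Fin n) ℝ) : Prop :=
  ∀ z ∈ spectrum ℂ (A.map Complex.ofReal), 0 < z.re

/-- The standing assumption on the dynamics `x' = A x + B u`: the matrix `B` has rank `m` and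
`(A, B)` satisfies the Kalman controllability condition. -/
structure AdmissibleDynamics (A : Matrix (Fin n) (Fin n) ℝ) (B : Matrix (Fin n) (Fin m) ℝ) :
    Prop where
  rank_eq : B.rank = m
  kalman : Submodule.span ℝ
    {x : Fin n → ℝ | ∃ i : ℕ, i < n ∧ ∃ v : Fin m → ℝ, x = (A ^ i * B) *ᵥ v} = ⊤

/-- The Hamiltonian matrix of the linear-quadratic problem `(A, B, Q, S, R)`. -/
def hamiltonian (A : Matrix (Fin n) (Fin n) ℝ) (B : Matrix (Fin n) (Fin m) ℝ)
    (Q : Matrix (Fin n) (Fin n) ℝ) (S : Matrix (Fin n) (Fin m) ℝ) (R : Matrix (Fin m) (Fin m) ℝ) :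
    Matrix (Fin n ⊕ Fin n) (Fin n ⊕ Fin n) ℝ :=
  Matrix.fromBlocks (A - B * R⁻¹ * Sᵀ) (B * R⁻¹ * Bᵀ) (Q - S * R⁻¹ * Sᵀ) (-Aᵀ + S * R⁻¹ * Bᵀ)

/-- The standing assumption on the autonomous cost `xᵀ Q x + 2 xᵀ S u + uᵀ R u`. -/
structure AdmissibleCost (A : Matrix (Fin n) (Fin n) ℝ) (B : Matrix (Fin n) (Fin m) ℝ)
    (Q : Matrix (Fin n) (Fin n) ℝ) (S : Matrix (Fin n) (Fin m) ℝ) (R : Matrix (Fin m) (Fin m) ℝ) :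
    Prop where
  symm : Q.IsSymm
  posDef : R.PosDef
  no_imaginary_eigenvalue :
    ∀ z ∈ spectrum ℂ ((hamiltonian A B Q S R).map Complex.ofReal), z.re ≠ 0

/-- `P` is a symmetric solution of the algebraic Riccati equation of `(A, B, Q, S, R)`. -/
structure IsRiccatiSolution (A : Matrix (Fin n) (Fin n) ℝ) (B : Matrix (Fin n) (Fin m) ℝ)
    (Q : Matrix (Fin n) (Fin n) ℝ) (S : Matrix (Fin n) (Fin m) ℝ) (R : Matrix (Fin m) (Fin m) ℝ)
    (P : Matrix (Fin n) (Fin n) ℝ) : Prop where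
  symm : P.IsSymm
  riccati : P * A + Aᵀ * P - (S + P * B) * R⁻¹ * (Sᵀ + Bᵀ * P) + Q = 0

/-- The closed-loop matrix `A - B R⁻¹ (Sᵀ + Bᵀ P)`. -/
def closedLoop (A : Matrix (Fin n) (Fin n) ℝ) (B : Matrix (Fin n) (Fin m) ℝ)
    (S : Matrix (Fin n) (Fin m) ℝ) (R : Matrix (Fin m) (Fin m) ℝ)
    (P : Matrix (Fin n) (Fin n) ℝ) : Matrix (Fin n) (Fin n) ℝ :=
  A - B * R⁻¹ * (Sᵀ + Bᵀ * P)

/-- `(Ap, Am)` is the pair `(A₊, A₋)` attached to the problem `(A, B, Q, S, R)`: the closed-loop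
matrices of the stabilizing and of the anti-stabilizing solution of the algebraic Riccati
equation. -/
def IsSynthesisPair (A : Matrix (Fin n) (Fin n) ℝ) (B : Matrix (Fin n) (Fin m) ℝ)
    (Q : Matrix (Fin n) (Fin n) ℝ) (S : Matrix (Fin n) (Fin m) ℝ) (R : Matrix (Fin m) (Fin m) ℝ)
    (Ap Am : Matrix (Fin n) (Fin n) ℝ) : Prop :=
  (∃ P, IsRiccatiSolution A B Q S R P ∧ Ap = closedLoop A B S R P ∧ IsStable Ap) ∧
  (∃ P, IsRiccatiSolution A B Q S R P ∧ Am = closedLoop A B S R P ∧ IsAntiStable Am)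

/-- The set `𝒥` of pairs `(A₊, A₋)` attached to the autonomous linear-quadratic problems with
dynamics `(A, B)`. -/
def synthesisPairs (A : Matrix (Fin n) (Fin n) ℝ) (B : Matrix (Fin n) (Fin m) ℝ) :
    Set (Matrix (Fin n) (Fin n) ℝ × Matrix (Fin n) (Fin n) ℝ) :=
  {p | ∃ Q S R, AdmissibleCost A B Q S R ∧ IsSynthesisPair A B Q S R p.1 p.2}

/-- `x` is on `[t₀, t₁]` the (absolutely continuous) trajectory of `x' = A x + B u` driven by the
square-integrable control `u`. -/
structure IsTrajectory (A : Matrix (Fin n) (Fin n) ℝ) (B : Matrix (Fin n) (Fin m) ℝ)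
    (t₀ t₁ : ℝ) (x : ℝ → Fin n → ℝ) (u : ℝ → Fin m → ℝ) : Prop where
  memLp : MemLp u 2 (volume.restrict (Icc t₀ t₁))
  continuousOn : ContinuousOn x (Icc t₀ t₁)
  integral_eq : ∀ t ∈ Icc t₀ t₁, x t = x t₀ + ∫ s in t₀..t, (A *ᵥ x s + B *ᵥ u s)

/-- The integral cost of the control `u` and the trajectory `x` on `[t₀, t₁]`. -/
def cost (Q : Matrix (Fin n) (Fin n) ℝ) (S : Matrix (Fin n) (Fin m) ℝ)
    (R : Matrix (Fin m) (Fin m) ℝ) (t₀ t₁ : ℝ) (x : ℝ → Fin n → ℝ) (u : ℝ → Fin m → ℝ) : ℝ :=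
  ∫ t in t₀..t₁, (x t ⬝ᵥ Q *ᵥ x t + 2 * (x t ⬝ᵥ S *ᵥ u t) + u t ⬝ᵥ R *ᵥ u t)

/-- `x` is on `[t₀, t₁]` a minimizing trajectory of the problem `(A, B, Q, S, R)` among all
trajectories with the same end points. -/
def IsMinimizing (A : Matrix (Fin n) (Fin n) ℝ) (B : Matrix (Fin n) (Fin m) ℝ)
    (Q : Matrix (Fin n) (Fin n) ℝ) (S : Matrix (Fin n) (Fin m) ℝ) (R : Matrix (Fin m) (Fin m) ℝ)
    (t₀ t₁ : ℝ) (x : ℝ → Fin n → ℝ) : Prop :=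
  ∃ u, IsTrajectory A B t₀ t₁ x u ∧
    ∀ x' u', IsTrajectory A B t₀ t₁ x' u' → x' t₀ = x t₀ → x' t₁ = x t₁ →
      cost Q S R t₀ t₁ x u ≤ cost Q S R t₀ t₁ x' u'

/-- The pair `(Ap, Am)` describes the optimal synthesis of `(A, B, Q, S, R)`: for all data there is
exactly one minimizing trajectory on `[t₀, t₁]`, and it can be written in exactly one way as
`exp (t Ap) y₊ + exp (t Am) y₋`. -/
def DescribesSynthesis (A : Matrix (Fin n) (Fin n) ℝ) (B : Matrix (Fin n) (Fin m) ℝ)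
    (Q : Matrix (Fin n) (Fin n) ℝ) (S : Matrix (Fin n) (Fin m) ℝ) (R : Matrix (Fin m) (Fin m) ℝ)
    (Ap Am : Matrix (Fin n) (Fin n) ℝ) : Prop :=
  ∀ t₀ t₁ : ℝ, t₀ < t₁ → ∀ x₀ x₁ : Fin n → ℝ,
    (∃ x, IsMinimizing A B Q S R t₀ t₁ x ∧ x t₀ = x₀ ∧ x t₁ = x₁) ∧
    (∀ x x', IsMinimizing A B Q S R t₀ t₁ x → x t₀ = x₀ → x t₁ = x₁ →
      IsMinimizing A B Q S R t₀ t₁ x' → x' t₀ = x₀ → x' t₁ = x₁ → EqOn x x' (Icc t₀ t₁)) ∧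
    (∀ x, IsMinimizing A B Q S R t₀ t₁ x → x t₀ = x₀ → x t₁ = x₁ →
      ∃! y : (Fin n → ℝ) × (Fin n → ℝ), ∀ t ∈ Icc t₀ t₁,
        x t = NormedSpace.exp (t • Ap) *ᵥ y.1 + NormedSpace.exp (t • Am) *ᵥ y.2)

end AutonomousLQ

end

/-! ### Stable and anti-stable matrices: disjoint spectra, Cayley transform, Lyapunov -/

namespace AutonomousLQ

open Polynomial Filter Topology

variable {n m : ℕ}

/-! Algebra. Put Δ = P₊ - P₋. Subtracting the two Riccati equations gives Δ A₊ + A₋ᵀ Δ = 0, and the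
closed loops satisfy A₋ = A₊ + B R⁻¹ Bᵀ Δ. Hence Δ A₊ + A₊ᵀ Δ = -Δ B R⁻¹ Bᵀ Δ ≤ 0, so Lyapunov's
theorem gives Δ ≥ 0. On ker Δ, which is A₊-invariant, A₊ and A₋ agree, so the kernel is trivial
because their spectra are disjoint (`posDef_riccati_sub`). Then A₊ Δ⁻¹ + Δ⁻¹ A₊ᵀ = -B R⁻¹ Bᵀ, and
compressing by the left inverse (BᵀB)⁻¹Bᵀ of B leaves -R⁻¹, which is condition 3. Conversely,
condition 3 dictates R, and the cost (u + K₋x)ᵀ R (u + K₋x) works: its Riccati equation is solved by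
0 and by Δ, with closed loops A₋ and A₊ (`mem_synthesisPairs_of_exists_gains`).

Optimality. Each Riccati solution yields extremals with adjoint state q = P x, and extremals add up.
A competitor costs more than an extremal by the cost of their difference, a loop at the origin.
Completing the square with a Riccati solution shows that loops have nonnegative cost, and zero cost
only if trivial. So extremals are the unique minimizers, and (y₊, y₋) ↦ (x(t₀), x(t₁)) is an
injective endomorphism of ℝⁿ × ℝⁿ, hence bijective (`describesSynthesis_of_isSynthesisPair`). -/

theorem isCoprime_charpoly {A B : Matrix (Fin n) (Fin n) ℝ} (hA : IsStable A)
    (hB : IsAntiStable B) : IsCoprime A.charpoly B.charpoly := by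
  rw [Polynomial.isCoprime_iff_aeval_ne_zero_of_isAlgClosed (k := ℝ) ℂ]
  intro z
  by_contra! h
  have key : ∀ M : Matrix (Fin n) (Fin n) ℝ, aeval z M.charpoly = 0 →
      z ∈ spectrum ℂ (M.map Complex.ofReal) := by
    intro M hM
    rw [Matrix.mem_spectrum_iff_isRoot_charpoly]
    have := Matrix.charpoly_map M Complex.ofRealHom
    change (M.map Complex.ofReal).charpoly = _ at this
    rw [this, IsRoot.def, eval_map]
    exact hM
  exact lt_asymm (hA z (key A h.1)) (hB z (key B h.2))

/-- If the orbits of `x` under a stable and of `y` under an anti-stable matrix cancel, then both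
vectors vanish. -/
theorem eq_zero_of_pow_mulVec_add_eq_zero {A B : Matrix (Fin n) (Fin n) ℝ} (hA : IsStable A)
    (hB : IsAntiStable B) {x y : Fin n → ℝ}
    (h : ∀ k : ℕ, (A ^ k) *ᵥ x + (B ^ k) *ᵥ y = 0) : x = 0 ∧ y = 0 := by
  have hp : ∀ p : ℝ[X], (aeval A p) *ᵥ x + (aeval B p) *ᵥ y = 0 := by
    intro p
    induction p using Polynomial.induction_on' with
    | add p q hp hq =>
      simp only [map_add, Matrix.add_mulVec]
      rw [add_add_add_comm, hp, hq, add_zero]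
    | monomial k a =>
      simp only [aeval_monomial, ← Algebra.smul_def, Matrix.smul_mulVec]
      rw [← smul_add, h, smul_zero]
  have hx : x = 0 := by
    -- By Cayley-Hamilton, the Bézout term `v * B.charpoly` evaluates to 0 at `B` and to 1 at `A`,
    -- so it isolates `x`.
    obtain ⟨u, v, huv⟩ := isCoprime_charpoly hA hB
    have h1 := hp (v * B.charpoly)
    simp only [map_mul, Matrix.aeval_self_charpoly, mul_zero, Matrix.zero_mulVec, add_zero] at h1
    have h2 := congrArg (fun p => (aeval A p) *ᵥ x) huv
    simpa [Matrix.add_mulVec, Matrix.aeval_self_charpoly, h1] using h2.symm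
  refine ⟨hx, ?_⟩
  simpa [hx] using h 0

theorem mem_spectrum_iff_exists_mulVec {M : Matrix (Fin n) (Fin n) ℂ} {z : ℂ} :
    z ∈ spectrum ℂ M ↔ ∃ v : Fin n → ℂ, v ≠ 0 ∧ M *ᵥ v = z • v := by
  rw [spectrum.mem_iff, Matrix.isUnit_iff_isUnit_det, isUnit_iff_ne_zero, not_not,
    ← Matrix.exists_mulVec_eq_zero_iff]
  refine exists_congr fun v => and_congr_right fun _ => ?_
  rw [Matrix.sub_mulVec, Algebra.algebraMap_eq_smul_one, Matrix.smul_mulVec, Matrix.one_mulVec,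
    sub_eq_zero, eq_comm]

section Norm

attribute [local instance] Matrix.linftyOpNormedRing Matrix.linftyOpNormedAlgebra

/-- Gelfand's formula: the spectral radius is below some r < 1, so ‖C ^ k‖ ≤ r ^ k eventually. -/
theorem tendsto_pow_of_spectrum_lt_one {C : Matrix (Fin n) (Fin n) ℂ}
    (h : ∀ z ∈ spectrum ℂ C, ‖z‖ < 1) : Tendsto (fun k : ℕ => C ^ k) atTop (𝓝 0) := by
  rcases subsingleton_or_nontrivial (Matrix (Fin n) (Fin n) ℂ) with hs | hs
  · convert tendsto_const_nhds
  have hr : spectralRadius ℂ C < (1 : NNReal) :=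
    spectrum.spectralRadius_lt_of_forall_lt C fun z hz => by
      rw [← NNReal.coe_lt_coe]; exact h z hz
  obtain ⟨r, hr1, hr2⟩ := ENNReal.lt_iff_exists_nnreal_btwn.1 hr
  have hg := (spectrum.pow_nnnorm_pow_one_div_tendsto_nhds_spectralRadius C).eventually_lt_const hr1
  have hr2' : (r : ℝ) < 1 := by exact_mod_cast hr2
  refine squeeze_zero_norm' ?_ (tendsto_pow_atTop_nhds_zero_of_lt_one r.2 hr2')
  filter_upwards [hg, eventually_gt_atTop 0] with k hk hk0
  have hk0' : (0 : ℝ) < k := by exact_mod_cast hk0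
  have := ENNReal.rpow_le_rpow hk.le hk0'.le
  rw [← ENNReal.rpow_mul, one_div_mul_cancel hk0'.ne', ENNReal.rpow_one, ENNReal.rpow_natCast]
    at this
  exact_mod_cast this

end Norm

theorem map_ofReal_mulVec (M : Matrix (Fin n) (Fin n) ℝ) (x : Fin n → ℝ) :
    (M.map Complex.ofReal) *ᵥ (fun i => (x i : ℂ)) = fun i => ((M *ᵥ x) i : ℂ) := by
  ext i
  simp [Matrix.mulVec, dotProduct]

theorem tendsto_pow_mulVec_of_spectrum_lt_one {C : Matrix (Fin n) (Fin n) ℝ}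
    (h : ∀ z ∈ spectrum ℂ (C.map Complex.ofReal), ‖z‖ < 1) (x : Fin n → ℝ) :
    Tendsto (fun k : ℕ => (C ^ k) *ᵥ x) atTop (𝓝 0) := by
  have h1 := tendsto_pow_of_spectrum_lt_one h
  have h2 : Tendsto (fun k : ℕ => C ^ k) atTop (𝓝 0) := by
    have h3 : Continuous fun M : Matrix (Fin n) (Fin n) ℂ => M.map Complex.re :=
      Continuous.matrix_map continuous_id Complex.continuous_re
    have h4 := (h3.tendsto 0).comp h1
    convert h4 using 2 with k
    · have : (C.map Complex.ofReal) ^ k = (C ^ k).map Complex.ofReal :=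
        (map_pow (Complex.ofRealHom.mapMatrix (m := Fin n)) C k).symm
      ext i j
      simp [this]
    · ext i j; simp
  have h5 : Continuous fun M : Matrix (Fin n) (Fin n) ℝ => M *ᵥ x := by fun_prop
  simpa only [Matrix.zero_mulVec, Function.comp_def] using (h5.tendsto 0).comp h2

theorem IsStable.isUnit_one_sub {A : Matrix (Fin n) (Fin n) ℝ} (hA : IsStable A) :
    IsUnit (1 - A) := by
  rw [Matrix.isUnit_iff_isUnit_det, isUnit_iff_ne_zero]
  intro h0
  obtain ⟨v, hv, hv0⟩ := Matrix.exists_mulVec_eq_zero_iff.2 h0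
  rw [Matrix.sub_mulVec, Matrix.one_mulVec, sub_eq_zero] at hv0
  have : (1 : ℂ) ∈ spectrum ℂ (A.map Complex.ofReal) := by
    rw [mem_spectrum_iff_exists_mulVec]
    refine ⟨fun i => v i, fun h => hv ?_, ?_⟩
    · ext i; simpa using congrFun h i
    · rw [map_ofReal_mulVec, ← hv0]; simp
  have := hA 1 this
  norm_num at this

/-- The Cayley transform of a stable matrix has its spectrum in the open unit disc. -/
theorem IsStable.norm_lt_one_of_mem_spectrum_cayley {A : Matrix (Fin n) (Fin n) ℝ}
    (hA : IsStable A) :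
    ∀ z ∈ spectrum ℂ (((1 + A) * (1 - A)⁻¹).map Complex.ofReal), ‖z‖ < 1 := by
  intro z hz
  have hdet := (Matrix.isUnit_iff_isUnit_det _).1 hA.isUnit_one_sub
  have hC : (((1 + A) * (1 - A)⁻¹).map Complex.ofReal) * (1 - A.map Complex.ofReal) =
      1 + A.map Complex.ofReal := by
    have h1 : ((1 + A) * (1 - A)⁻¹) * (1 - A) = 1 + A := by
      rw [Matrix.mul_assoc, Matrix.nonsing_inv_mul _ hdet, Matrix.mul_one]
    have h2 : Complex.ofRealHom.mapMatrix ((1 + A) * (1 - A)⁻¹) *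
        Complex.ofRealHom.mapMatrix (1 - A) = Complex.ofRealHom.mapMatrix (1 + A) := by
      rw [← map_mul, h1]
    simp only [map_sub, map_add, map_one] at h2
    exact h2
  have hD : (1 - A.map Complex.ofReal) * ((1 - A)⁻¹.map Complex.ofReal) = 1 := by
    have h2 := congrArg (Complex.ofRealHom.mapMatrix (m := Fin n)) (Matrix.mul_nonsing_inv _ hdet)
    simp only [map_mul, map_sub, map_one] at h2
    exact h2
  obtain ⟨v, hv, hzv⟩ := mem_spectrum_iff_exists_mulVec.1 hz
  set Ac := A.map Complex.ofReal with hAc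
  set w := ((1 - A)⁻¹.map Complex.ofReal) *ᵥ v with hw
  have hvw : v = (1 - Ac) *ᵥ w := by
    rw [hw, Matrix.mulVec_mulVec, hD, Matrix.one_mulVec]
  have hw0 : w ≠ 0 := by
    intro h; rw [h, Matrix.mulVec_zero] at hvw; exact hv hvw
  have e1 : (1 + Ac) *ᵥ w = z • ((1 - Ac) *ᵥ w) := by
    rw [← hC, ← Matrix.mulVec_mulVec, ← hvw, hzv]
  rw [Matrix.add_mulVec, Matrix.sub_mulVec, Matrix.one_mulVec] at e1
  have e2 : (z + 1) • (Ac *ᵥ w) = (z - 1) • w := by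
    have : w + Ac *ᵥ w - z • (w - Ac *ᵥ w) = 0 := by rw [e1, sub_self]
    rw [← sub_eq_zero, ← this]; module
  -- At z = -1 the relation `e2` would read 0 = -2 w.
  have hz1 : z + 1 ≠ 0 := by
    intro h
    rw [h, zero_smul] at e2
    have : z - 1 ≠ 0 := by
      rw [eq_neg_of_add_eq_zero_left h]; norm_num
    exact hw0 ((smul_eq_zero.1 e2.symm).resolve_left this)
  have e3 : (z - 1) / (z + 1) ∈ spectrum ℂ Ac := by
    rw [mem_spectrum_iff_exists_mulVec]
    refine ⟨w, hw0, ?_⟩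
    rw [div_eq_inv_mul, mul_smul, ← e2, smul_smul, inv_mul_cancel₀ hz1, one_smul]
  have e4 := hA _ e3
  -- The real part of (z - 1) / (z + 1) has the sign of |z|² - 1.
  have hpos : 0 < Complex.normSq (z + 1) := Complex.normSq_pos.2 hz1
  rw [Complex.div_re, ← add_div, div_neg_iff] at e4
  have e5 : (z - 1).re * (z + 1).re + (z - 1).im * (z + 1).im < 0 := by
    rcases e4 with h | h
    · linarith [h.2]
    · exact h.1
  simp only [Complex.sub_re, Complex.add_re, Complex.one_re, Complex.sub_im, Complex.add_im,
    Complex.one_im] at e5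
  have e6 : ‖z‖ ^ 2 < 1 := by
    rw [← Complex.normSq_eq_norm_sq, Complex.normSq_apply]; nlinarith
  nlinarith [norm_nonneg z]

/-- Lyapunov's theorem. -/
theorem IsStable.posSemidef_of_lyapunov {A D : Matrix (Fin n) (Fin n) ℝ} (hA : IsStable A)
    (hD : D.IsSymm) (h : ∀ w : Fin n → ℝ, w ⬝ᵥ D *ᵥ (A *ᵥ w) ≤ 0) : D.PosSemidef := by
  refine Matrix.PosSemidef.of_dotProduct_mulVec_nonneg (by rwa [Matrix.IsHermitian,
    Matrix.conjTranspose_eq_transpose_of_trivial]) fun x => ?_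
  rw [star_trivial]
  -- The Cayley transform replaces the flow by an iteration. With v = (1 - A) w, the form q attached
  -- to `D` satisfies q(C v) - q(v) = 4 wᵀ D A w ≤ 0. Thus q decreases along C ^ k x → 0, and q(x) ≥
  -- 0.
  set C := (1 + A) * (1 - A)⁻¹ with hC
  have hdet := (Matrix.isUnit_iff_isUnit_det _).1 hA.isUnit_one_sub
  have hstep : ∀ v : Fin n → ℝ, (C *ᵥ v) ⬝ᵥ D *ᵥ (C *ᵥ v) ≤ v ⬝ᵥ D *ᵥ v := by
    intro v
    set w := (1 - A)⁻¹ *ᵥ v with hw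
    have h1 : v = w - A *ᵥ w := by
      have : v = (1 - A) *ᵥ w := by
        rw [hw, Matrix.mulVec_mulVec, Matrix.mul_nonsing_inv _ hdet, Matrix.one_mulVec]
      rwa [Matrix.sub_mulVec, Matrix.one_mulVec] at this
    have h2 : C *ᵥ v = w + A *ᵥ w := by
      rw [hC, ← Matrix.mulVec_mulVec, ← hw, Matrix.add_mulVec, Matrix.one_mulVec]
    have h3 : (A *ᵥ w) ⬝ᵥ D *ᵥ w = w ⬝ᵥ D *ᵥ (A *ᵥ w) := by
      rw [Matrix.dotProduct_mulVec, ← Matrix.mulVec_transpose, hD.eq, dotProduct_comm]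
    rw [h2, h1]
    simp only [Matrix.mulVec_add, Matrix.mulVec_sub, add_dotProduct, sub_dotProduct,
      dotProduct_add, dotProduct_sub]
    linarith [h w]
  have hmono : ∀ k : ℕ, ((C ^ k) *ᵥ x) ⬝ᵥ D *ᵥ ((C ^ k) *ᵥ x) ≤ x ⬝ᵥ D *ᵥ x := by
    intro k
    induction k with
    | zero => simp
    | succ k ih =>
      rw [pow_succ', ← Matrix.mulVec_mulVec]
      exact (hstep _).trans ih
  have hlim := tendsto_pow_mulVec_of_spectrum_lt_one hA.norm_lt_one_of_mem_spectrum_cayley x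
  have hcont : Continuous fun v : Fin n → ℝ => v ⬝ᵥ D *ᵥ v := by fun_prop
  have hlim2 := (hcont.tendsto 0).comp hlim
  simp only [zero_dotProduct] at hlim2
  exact le_of_tendsto hlim2 (Eventually.of_forall hmono)

end AutonomousLQ

/-! ### Pairs of Riccati solutions and the characterization of the synthesis pairs -/

namespace AutonomousLQ

variable {n m : ℕ}

theorem isUnit_det_transpose_mul_self {B : Matrix (Fin n) (Fin m) ℝ} (hB : B.rank = m) :
    IsUnit (Bᵀ * B).det := by
  have hli : LinearIndependent ℝ B.col := by
    rw [linearIndependent_iff_card_eq_finrank_span, Set.finrank,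
      ← Matrix.rank_eq_finrank_span_cols, hB, Fintype.card_fin]
  have hinj := Matrix.mulVec_injective_iff.2 hli
  rw [isUnit_iff_ne_zero]
  intro h0
  obtain ⟨v, hv, hv0⟩ := Matrix.exists_mulVec_eq_zero_iff.2 h0
  have h1 : (B *ᵥ v) ⬝ᵥ (B *ᵥ v) = 0 := by
    have h2 : v ⬝ᵥ ((Bᵀ * B) *ᵥ v) = 0 := by rw [hv0, dotProduct_zero]
    rwa [← Matrix.mulVec_mulVec, Matrix.dotProduct_mulVec, Matrix.vecMul_transpose] at h2
  refine hv (hinj ?_)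
  rw [dotProduct_self_eq_zero.1 h1, Matrix.mulVec_zero]

section Riccati

variable {A : Matrix (Fin n) (Fin n) ℝ} {B : Matrix (Fin n) (Fin m) ℝ}
  {Q : Matrix (Fin n) (Fin n) ℝ} {S : Matrix (Fin n) (Fin m) ℝ} {R : Matrix (Fin m) (Fin m) ℝ}
  {P P' : Matrix (Fin n) (Fin n) ℝ}

theorem transpose_eq_of_posDef {k : ℕ} {M : Matrix (Fin k) (Fin k) ℝ} (h : M.PosDef) : Mᵀ = M := by
  have := h.isHermitian
  rwa [Matrix.IsHermitian, Matrix.conjTranspose_eq_transpose_of_trivial] at this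

theorem closedLoop_sub (P P' : Matrix (Fin n) (Fin n) ℝ) :
    closedLoop A B S R P' = closedLoop A B S R P + B * R⁻¹ * Bᵀ * (P - P') := by
  simp only [closedLoop, Matrix.mul_add, Matrix.mul_sub, ← Matrix.mul_assoc]
  abel

/-- Difference of the two Riccati equations. Using one closed loop on each side absorbs all the
quadratic terms, including the mixed ones. -/
theorem IsRiccatiSolution.sub_mul_closedLoop (hR : R.PosDef) (h : IsRiccatiSolution A B Q S R P)
    (h' : IsRiccatiSolution A B Q S R P') :
    (P - P') * closedLoop A B S R P + (closedLoop A B S R P')ᵀ * (P - P') = 0 := by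
  have h1 := h.riccati
  have h2 := h'.riccati
  rw [← sub_self (0 : Matrix (Fin n) (Fin n) ℝ)]
  nth_rw 1 [← h1]
  rw [← h2]
  simp only [closedLoop, Matrix.transpose_sub, Matrix.transpose_mul, Matrix.transpose_add,
    Matrix.transpose_transpose, transpose_eq_of_posDef hR.inv, h'.symm.eq, Matrix.mul_add,
    Matrix.mul_sub, Matrix.add_mul, Matrix.sub_mul, ← Matrix.mul_assoc]
  abel

/-- The kernel of `D` is invariant under `F` by `h1`, and `H` equals `F` there by `h2`. A kernel
vector would have the same orbit under a stable and an anti-stable matrix. -/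
theorem isUnit_of_stable_of_antiStable {F H D G : Matrix (Fin n) (Fin n) ℝ} (hF : IsStable F)
    (hH : IsAntiStable H) (h1 : D * F + Hᵀ * D = 0) (h2 : H = F + G * D) : IsUnit D := by
  rw [Matrix.isUnit_iff_isUnit_det, isUnit_iff_ne_zero]
  intro h0
  obtain ⟨v, hv, hv0⟩ := Matrix.exists_mulVec_eq_zero_iff.2 h0
  have hker : ∀ w, D *ᵥ w = 0 → D *ᵥ (F *ᵥ w) = 0 ∧ H *ᵥ w = F *ᵥ w := by
    intro w hw
    constructor
    · rw [Matrix.mulVec_mulVec, eq_neg_of_add_eq_zero_left h1, Matrix.neg_mulVec,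
        ← Matrix.mulVec_mulVec, hw, Matrix.mulVec_zero, neg_zero]
    · rw [h2, Matrix.add_mulVec, ← Matrix.mulVec_mulVec w G D, hw, Matrix.mulVec_zero, add_zero]
  have hpow : ∀ k : ℕ, D *ᵥ ((F ^ k) *ᵥ v) = 0 ∧ (H ^ k) *ᵥ v = (F ^ k) *ᵥ v := by
    intro k
    induction k with
    | zero => simpa using hv0
    | succ k ih =>
      obtain ⟨i1, i2⟩ := ih
      obtain ⟨j1, j2⟩ := hker _ i1
      rw [pow_succ', pow_succ', ← Matrix.mulVec_mulVec, ← Matrix.mulVec_mulVec, i2]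
      exact ⟨j1, j2⟩
  refine hv (eq_zero_of_pow_mulVec_add_eq_zero hF hH (y := -v) fun k => ?_).1
  rw [Matrix.mulVec_neg, (hpow k).2, add_neg_cancel]

/-- The gap between the stabilizing and the anti-stabilizing solution is positive definite. -/
theorem posDef_riccati_sub (hR : R.PosDef) (h : IsRiccatiSolution A B Q S R P)
    (h' : IsRiccatiSolution A B Q S R P') (hs : IsStable (closedLoop A B S R P))
    (ha : IsAntiStable (closedLoop A B S R P')) : (P - P').PosDef := by
  have hD : (P - P').IsSymm := h.symm.sub h'.symm
  have e1 := h.sub_mul_closedLoop hR h'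
  have e2 := closedLoop_sub (A := A) (B := B) (S := S) (R := R) P P'
  set F := closedLoop A B S R P
  set H := closedLoop A B S R P'
  set D := P - P'
  refine (Matrix.PosSemidef.posDef_iff_isUnit ?_).2 (isUnit_of_stable_of_antiStable hs ha e1 e2)
  refine hs.posSemidef_of_lyapunov hD fun w => ?_
  have e3 : w ⬝ᵥ D *ᵥ (F *ᵥ w) + w ⬝ᵥ Hᵀ *ᵥ (D *ᵥ w) = 0 := by
    rw [← dotProduct_add, Matrix.mulVec_mulVec, Matrix.mulVec_mulVec, ← Matrix.add_mulVec, e1,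
      Matrix.zero_mulVec, dotProduct_zero]
  -- With `e3` this gives 2 wᵀ D F w = -(BᵀDw)ᵀ R⁻¹ (BᵀDw) ≤ 0, the Lyapunov inequality.
  have e4 : w ⬝ᵥ Hᵀ *ᵥ (D *ᵥ w) =
      w ⬝ᵥ D *ᵥ (F *ᵥ w) + (Bᵀ *ᵥ (D *ᵥ w)) ⬝ᵥ R⁻¹ *ᵥ (Bᵀ *ᵥ (D *ᵥ w)) := by
    have e5 : H *ᵥ w = F *ᵥ w + B *ᵥ (R⁻¹ *ᵥ (Bᵀ *ᵥ (D *ᵥ w))) := by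
      rw [e2, Matrix.add_mulVec]; simp only [Matrix.mulVec_mulVec, Matrix.mul_assoc]
    rw [Matrix.dotProduct_mulVec, Matrix.vecMul_transpose, e5, add_dotProduct]
    congr 1
    · rw [Matrix.dotProduct_mulVec, ← Matrix.mulVec_transpose, hD.eq, dotProduct_comm,
        Matrix.dotProduct_mulVec w, ← Matrix.mulVec_transpose, hD.eq]
    · rw [dotProduct_comm, Matrix.dotProduct_mulVec, ← Matrix.mulVec_transpose]
  have e6 := (hR.inv.posSemidef).dotProduct_mulVec_nonneg (Bᵀ *ᵥ (D *ᵥ w))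
  rw [star_trivial] at e6
  linarith

end Riccati

theorem spectrum_transpose (M : Matrix (Fin n) (Fin n) ℂ) : spectrum ℂ Mᵀ = spectrum ℂ M := by
  ext z
  rw [Matrix.mem_spectrum_iff_isRoot_charpoly, Matrix.mem_spectrum_iff_isRoot_charpoly,
    Matrix.charpoly_transpose]

/-- -F is similar to Hᵀ, which has the spectrum of H. -/
theorem isAntiStable_of_conj_neg_transpose {F H D : Matrix (Fin n) (Fin n) ℝ} (hD : IsUnit D)
    (hF : IsStable F) (h : F = -(D⁻¹ * Hᵀ * D)) : IsAntiStable H := by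
  intro z hz
  obtain ⟨U, hU⟩ := hD
  let f : Matrix (Fin n) (Fin n) ℝ →+* Matrix (Fin n) (Fin n) ℂ := Complex.ofRealHom.mapMatrix
  have hf : ∀ M, f M = M.map Complex.ofReal := fun M => rfl
  have h1 : -F = ((U⁻¹ : (Matrix (Fin n) (Fin n) ℝ)ˣ) : Matrix (Fin n) (Fin n) ℝ) * Hᵀ * U := by
    rw [h, neg_neg, Matrix.coe_units_inv, hU]
  have h2 := congrArg f h1
  rw [map_mul, map_mul, map_neg] at h2
  have h3 : spectrum ℂ (-f F) = spectrum ℂ (f Hᵀ) := by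
    rw [h2]
    have := spectrum.units_conjugate' (R := ℂ) (a := f Hᵀ) (u := Units.map f.toMonoidHom U)
    simpa using this
  have h4 : f Hᵀ = (H.map Complex.ofReal)ᵀ := rfl
  rw [h4, spectrum_transpose, ← spectrum.neg_eq] at h3
  rw [← h3, Set.mem_neg] at hz
  have := hF _ hz
  simpa using this

theorem hamiltonian_no_imaginary {F G : Matrix (Fin n) (Fin n) ℝ} (hF : IsAntiStable F) :
    ∀ z ∈ spectrum ℂ ((Matrix.fromBlocks F G 0 (-Fᵀ)).map Complex.ofReal), z.re ≠ 0 := by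
  intro z hz
  have h0 : (0 : Matrix (Fin n) (Fin n) ℝ).map Complex.ofReal = 0 := by ext; simp
  have h1 : (-Fᵀ).map Complex.ofReal = -(F.map Complex.ofReal)ᵀ := by ext; simp
  rw [Matrix.fromBlocks_map, h0, h1, Matrix.mem_spectrum_iff_isRoot_charpoly,
    Matrix.charpoly_fromBlocks_zero₂₁, Polynomial.IsRoot.def, Polynomial.eval_mul,
    mul_eq_zero] at hz
  rcases hz with hz | hz
  · exact (hF z (Matrix.mem_spectrum_iff_isRoot_charpoly.2 hz)).ne'
  · have h2 := Matrix.mem_spectrum_iff_isRoot_charpoly.2 hz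
    rw [← spectrum.neg_eq, Set.mem_neg, spectrum_transpose] at h2
    have := hF _ h2
    rw [Complex.neg_re] at this
    linarith

/-- The witness Δ is the gap between the two Riccati solutions, and the matrix of condition 3 turns
out to be -R⁻¹. -/
theorem exists_gains_of_mem_synthesisPairs {A : Matrix (Fin n) (Fin n) ℝ}
    {B : Matrix (Fin n) (Fin m) ℝ} (hB : B.rank = m)
    {p : Matrix (Fin n) (Fin n) ℝ × Matrix (Fin n) (Fin n) ℝ} (hp : p ∈ synthesisPairs A B) :
    ∃ Kp Km : Matrix (Fin m) (Fin n) ℝ, p.1 = A - B * Kp ∧ p.2 = A - B * Km ∧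
      ∃ Δ : Matrix (Fin n) (Fin n) ℝ, Δ.PosDef ∧ p.1 = -(Δ⁻¹ * p.2ᵀ * Δ) ∧ IsStable p.1 ∧
        (-((Bᵀ * B)⁻¹ * Bᵀ * (p.1 * Δ⁻¹ + Δ⁻¹ * p.1ᵀ) * B * (Bᵀ * B)⁻¹)).PosDef := by
  obtain ⟨Q, S, R, hQ, ⟨P, hP, hp1, hs⟩, P', hP', hp2, ha⟩ := hp
  have hD := posDef_riccati_sub hQ.posDef hP hP' (hp1 ▸ hs) (hp2 ▸ ha)
  have e1 := hP.sub_mul_closedLoop hQ.posDef hP'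
  have e2 := closedLoop_sub (A := A) (B := B) (S := S) (R := R) P P'
  rw [← hp1, ← hp2] at e1 e2
  have hR := hQ.posDef
  have hT := isUnit_det_transpose_mul_self hB
  have hdet := (Matrix.isUnit_iff_isUnit_det _).1 hD.isUnit
  have e3 : p.2ᵀ * (P - P') = -((P - P') * p.1) := eq_neg_of_add_eq_zero_right e1
  refine ⟨R⁻¹ * (Sᵀ + Bᵀ * P), R⁻¹ * (Sᵀ + Bᵀ * P'), by rw [hp1, closedLoop, Matrix.mul_assoc],
    by rw [hp2, closedLoop, Matrix.mul_assoc], P - P', hD, ?_, hs, ?_⟩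
  · rw [Matrix.mul_assoc, e3, Matrix.mul_neg, neg_neg, ← Matrix.mul_assoc,
      Matrix.nonsing_inv_mul _ hdet, Matrix.one_mul]
  · have e4 : p.2ᵀ = -((P - P') * p.1 * (P - P')⁻¹) := by
      rw [← Matrix.neg_mul, ← e3, Matrix.mul_assoc, Matrix.mul_nonsing_inv _ hdet, Matrix.mul_one]
    have e5 : p.1ᵀ = p.2ᵀ - (P - P') * (B * R⁻¹ * Bᵀ) := by
      rw [e2, Matrix.transpose_add, Matrix.transpose_mul, Matrix.transpose_mul,
        Matrix.transpose_mul, Matrix.transpose_transpose, transpose_eq_of_posDef hR.inv,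
        transpose_eq_of_posDef hD, Matrix.mul_assoc B, add_sub_cancel_right]
    have e6 : p.1 * (P - P')⁻¹ + (P - P')⁻¹ * p.1ᵀ = -(B * R⁻¹ * Bᵀ) := by
      rw [e5, e4, Matrix.mul_sub, Matrix.mul_neg, ← Matrix.mul_assoc, ← Matrix.mul_assoc,
        ← Matrix.mul_assoc, Matrix.nonsing_inv_mul _ hdet, Matrix.one_mul, Matrix.one_mul]
      abel
    have e7 : -((Bᵀ * B)⁻¹ * Bᵀ * -(B * R⁻¹ * Bᵀ) * B * (Bᵀ * B)⁻¹) =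
        ((Bᵀ * B)⁻¹ * (Bᵀ * B)) * R⁻¹ * ((Bᵀ * B) * (Bᵀ * B)⁻¹) := by
      simp only [Matrix.mul_neg, Matrix.neg_mul, neg_neg, Matrix.mul_assoc]
    rw [e6, e7, Matrix.nonsing_inv_mul _ hT, Matrix.mul_nonsing_inv _ hT, Matrix.one_mul,
      Matrix.mul_one]
    exact hR.inv

/-- The factorization of a symmetric matrix whose range lies in the range of `B`. -/
theorem factor_of_range_subset {B : Matrix (Fin n) (Fin m) ℝ} (hT : IsUnit (Bᵀ * B).det)
    {M : Matrix (Fin n) (Fin n) ℝ} {L : Matrix (Fin m) (Fin n) ℝ} (hM : Mᵀ = M) (hL : M = B * L) :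
    B * ((Bᵀ * B)⁻¹ * Bᵀ * M * B * (Bᵀ * B)⁻¹) * Bᵀ = M := by
  -- B (BᵀB)⁻¹ Bᵀ is the orthogonal projection onto the range of B. It fixes M on the left, and on
  -- the right by symmetry.
  have h1 : B * (Bᵀ * B)⁻¹ * Bᵀ * M = M := by
    rw [hL, ← Matrix.mul_assoc, Matrix.mul_assoc _ Bᵀ B, Matrix.mul_assoc B,
      Matrix.nonsing_inv_mul _ hT, Matrix.mul_one]
  have h2 : M * (B * (Bᵀ * B)⁻¹ * Bᵀ) = M := by
    rw [← hM, hL, Matrix.transpose_mul, Matrix.mul_assoc, ← Matrix.mul_assoc Bᵀ,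
      ← Matrix.mul_assoc Bᵀ, Matrix.mul_nonsing_inv _ hT, Matrix.one_mul]
  calc _ = (B * (Bᵀ * B)⁻¹ * Bᵀ * M) * (B * (Bᵀ * B)⁻¹ * Bᵀ) := by simp only [Matrix.mul_assoc]
    _ = M := by rw [h1, h2]

/-- Let W be the positive definite matrix of `hN`. The cost (u + K₋x)ᵀ W⁻¹ (u + K₋x) has the Riccati
solution 0 with closed loop A₋. The matrix Δ is a second solution, with closed loop A₊. The
Hamiltonian becomes block triangular with diagonal blocks A₋ and -A₋ᵀ. -/
theorem mem_synthesisPairs_of_exists_gains {A : Matrix (Fin n) (Fin n) ℝ}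
    {B : Matrix (Fin n) (Fin m) ℝ} (hB : B.rank = m)
    {p : Matrix (Fin n) (Fin n) ℝ × Matrix (Fin n) (Fin n) ℝ}
    {Kp Km : Matrix (Fin m) (Fin n) ℝ} (h1 : p.1 = A - B * Kp) (h2 : p.2 = A - B * Km)
    {Δ : Matrix (Fin n) (Fin n) ℝ} (hΔ : Δ.PosDef) (h3 : p.1 = -(Δ⁻¹ * p.2ᵀ * Δ))
    (hs : IsStable p.1)
    (hN : (-((Bᵀ * B)⁻¹ * Bᵀ * (p.1 * Δ⁻¹ + Δ⁻¹ * p.1ᵀ) * B * (Bᵀ * B)⁻¹)).PosDef) :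
    p ∈ synthesisPairs A B := by
  have hT := isUnit_det_transpose_mul_self hB
  have hdet := (Matrix.isUnit_iff_isUnit_det _).1 hΔ.isUnit
  have ha : IsAntiStable p.2 := isAntiStable_of_conj_neg_transpose hΔ.isUnit hs h3
  have hΔt := transpose_eq_of_posDef hΔ
  have hΔit := transpose_eq_of_posDef hΔ.inv
  set M := p.1 * Δ⁻¹ + Δ⁻¹ * p.1ᵀ with hM
  have hMt : Mᵀ = M := by
    rw [hM, Matrix.transpose_add, Matrix.transpose_mul, Matrix.transpose_mul,
      Matrix.transpose_transpose, hΔit, add_comm]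
  have e1 : Δ * p.1 = -(p.2ᵀ * Δ) := by
    rw [h3, Matrix.mul_neg, ← Matrix.mul_assoc, ← Matrix.mul_assoc,
      Matrix.mul_nonsing_inv _ hdet, Matrix.one_mul]
  have e1' : p.1ᵀ * Δ = -(Δ * p.2) := by
    have := congrArg Matrix.transpose e1
    rwa [Matrix.transpose_mul, Matrix.transpose_neg, Matrix.transpose_mul,
      Matrix.transpose_transpose, hΔt] at this
  have e2 : M * Δ = p.1 - p.2 := by
    rw [hM, Matrix.add_mul, Matrix.mul_assoc, Matrix.nonsing_inv_mul _ hdet, Matrix.mul_assoc, e1',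
      Matrix.mul_neg, ← Matrix.mul_assoc, Matrix.nonsing_inv_mul _ hdet, Matrix.mul_one,
      Matrix.one_mul, sub_eq_add_neg]
  -- The feedback form of the pair puts the range of `M` inside that of `B`, so the compression in
  -- condition 3 determines `M`.
  have e3 : M = B * ((Km - Kp) * Δ⁻¹) := by
    have : M = M * Δ * Δ⁻¹ := by
      rw [Matrix.mul_assoc, Matrix.mul_nonsing_inv _ hdet, Matrix.mul_one]
    rw [this, e2, h1, h2, ← Matrix.mul_assoc, Matrix.mul_sub]
    congr 1
    abel
  have e4 := factor_of_range_subset hT hMt e3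
  set W := -((Bᵀ * B)⁻¹ * Bᵀ * M * B * (Bᵀ * B)⁻¹) with hW
  have e5 : B * W * Bᵀ = -M := by rw [hW, Matrix.mul_neg, Matrix.neg_mul, e4]
  have hWdet := (Matrix.isUnit_iff_isUnit_det _).1 hN.isUnit
  have hWi : W⁻¹⁻¹ = W := Matrix.nonsing_inv_nonsing_inv _ hWdet
  have hSt : (Kmᵀ * W⁻¹)ᵀ = W⁻¹ * Km := by
    rw [Matrix.transpose_mul, Matrix.transpose_transpose, transpose_eq_of_posDef hN.inv]
  have hWS : W * (W⁻¹ * Km) = Km := by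
    rw [← Matrix.mul_assoc, Matrix.mul_nonsing_inv _ hWdet, Matrix.one_mul]
  have hSW : Kmᵀ * W⁻¹ * W = Kmᵀ := by
    rw [Matrix.mul_assoc, Matrix.nonsing_inv_mul _ hWdet, Matrix.mul_one]
  have hKm : p.2ᵀ = Aᵀ - Kmᵀ * Bᵀ := by rw [h2, Matrix.transpose_sub, Matrix.transpose_mul]
  have hQ : (Kmᵀ * W⁻¹ * Km)ᵀ = Kmᵀ * W⁻¹ * Km := by
    rw [Matrix.transpose_mul, hSt, Matrix.mul_assoc]
  have e6 : closedLoop A B (Kmᵀ * W⁻¹) W⁻¹ 0 = p.2 := by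
    rw [closedLoop, Matrix.mul_zero, add_zero, hSt, hWi, Matrix.mul_assoc, hWS, h2]
  have e7 : closedLoop A B (Kmᵀ * W⁻¹) W⁻¹ Δ = p.1 := by
    have := closedLoop_sub (A := A) (B := B) (S := Kmᵀ * W⁻¹) (R := W⁻¹) Δ 0
    rw [e6, hWi, e5, sub_zero, Matrix.neg_mul, e2] at this
    refine sub_eq_zero.1 (neg_eq_zero.1 ?_)
    rw [← sub_eq_zero.2 this]
    abel
  refine ⟨Kmᵀ * W⁻¹ * Km, Kmᵀ * W⁻¹, W⁻¹, ⟨hQ, hN.inv, ?_⟩,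
    ⟨Δ, ⟨hΔt, ?_⟩, e7.symm, hs⟩, ⟨0, ⟨Matrix.transpose_zero, ?_⟩, e6.symm, ha⟩⟩
  · have : hamiltonian A B (Kmᵀ * W⁻¹ * Km) (Kmᵀ * W⁻¹) W⁻¹ =
        Matrix.fromBlocks p.2 (B * W * Bᵀ) 0 (-p.2ᵀ) := by
      rw [hamiltonian, hSt, hWi, hSW, Matrix.mul_assoc B W (W⁻¹ * Km), hWS, ← h2,
        ← Matrix.mul_assoc, sub_self, hKm]
      congr 1
      abel
    rw [this]
    exact hamiltonian_no_imaginary ha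
  · have e8 : Δ * A = Δ * p.2 + Δ * B * Km := by
      rw [h2, Matrix.mul_sub, Matrix.mul_assoc]; abel
    have e9 : Aᵀ * Δ = p.2ᵀ * Δ + Kmᵀ * Bᵀ * Δ := by
      rw [hKm, Matrix.sub_mul]; abel
    have e10 : p.2ᵀ * Δ = -(Δ * p.2) + Δ * (B * W * Bᵀ) * Δ := by
      have : Δ * p.1 = Δ * p.2 + Δ * (M * Δ) := by rw [e2, Matrix.mul_sub]; abel
      rw [e5, Matrix.mul_neg, Matrix.neg_mul, Matrix.mul_assoc, ← neg_inj, ← e1, this]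
      abel
    rw [hSt, hWi, Matrix.add_mul, hSW, Matrix.mul_add, Matrix.add_mul, Matrix.add_mul, e8, e9, e10,
      Matrix.mul_assoc (Δ * B) W (W⁻¹ * Km), hWS]
    simp only [← Matrix.mul_assoc]
    abel
  · rw [hSt, hWi, Matrix.mul_zero, Matrix.zero_mul, Matrix.zero_mul, Matrix.mul_zero, add_zero,
      add_zero, hSW, add_zero, zero_sub, Matrix.mul_assoc, neg_add_cancel]

end AutonomousLQ

/-! ### Trajectories: integration by parts and the cost of loops -/

namespace AutonomousLQ

open Filter Topology

variable {n m : ℕ}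

/-- On `[t₀, t₁]` the function `x` is a primitive of the integrable function `f`. -/
structure IsPrimitiveOn (t₀ t₁ : ℝ) (x f : ℝ → Fin n → ℝ) : Prop where
  integrableOn : IntegrableOn f (Icc t₀ t₁)
  integral_eq : ∀ t ∈ Icc t₀ t₁, x t = x t₀ + ∫ s in t₀..t, f s

/-- Controls are only square integrable, so this is the product rule for absolutely continuous
functions. `F` and `G` are replaced by integral primitives that agree with them on the interval and
are differentiable almost everywhere. -/
theorem integral_mul_add_mul_eq_sub {t₀ t₁ : ℝ} (ht : t₀ ≤ t₁) {F f G g : ℝ → ℝ}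
    (hf : IntervalIntegrable f volume t₀ t₁) (hg : IntervalIntegrable g volume t₀ t₁)
    (hF : ∀ t ∈ Icc t₀ t₁, F t = F t₀ + ∫ s in t₀..t, f s)
    (hG : ∀ t ∈ Icc t₀ t₁, G t = G t₀ + ∫ s in t₀..t, g s) :
    ∫ t in t₀..t₁, (f t * G t + F t * g t) = F t₁ * G t₁ - F t₀ * G t₀ := by
  have hac : ∀ (c : ℝ) {φ : ℝ → ℝ}, IntervalIntegrable φ volume t₀ t₁ →
      AbsolutelyContinuousOnInterval (fun t => c + ∫ s in t₀..t, φ s) t₀ t₁ := fun c φ hφ =>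
    ((contDiff_const (c := c)).contDiffOn.absolutelyContinuousOnInterval).add
      (hφ.absolutelyContinuousOnInterval_intervalIntegral (by simp))
  have key := (hac (F t₀) hf).integral_deriv_mul_eq_sub (hac (G t₀) hg)
  rw [← hF t₁ (right_mem_Icc.2 ht), ← hG t₁ (right_mem_Icc.2 ht),
    ← hF t₀ (left_mem_Icc.2 ht), ← hG t₀ (left_mem_Icc.2 ht)] at key
  rw [← key]
  refine intervalIntegral.integral_congr_ae ?_
  filter_upwards [hf.ae_hasDerivAt_integral, hg.ae_hasDerivAt_integral] with t h1 h2 h3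
  have h4 : t ∈ uIcc t₀ t₁ := uIoc_subset_uIcc h3
  have h5 : t ∈ Icc t₀ t₁ := by rwa [uIcc_of_le ht] at h4
  rw [((h1 h4 t₀ (by simp)).const_add _).deriv, ((h2 h4 t₀ (by simp)).const_add _).deriv,
    ← hF t h5, ← hG t h5]

namespace IsPrimitiveOn

variable {t₀ t₁ : ℝ} {x f q g : ℝ → Fin n → ℝ}

theorem continuousOn (h : IsPrimitiveOn t₀ t₁ x f) (ht : t₀ ≤ t₁) :
    ContinuousOn x (Icc t₀ t₁) := by
  refine ContinuousOn.congr ?_ h.integral_eq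
  refine continuousOn_const.add ?_
  have := intervalIntegral.continuousOn_primitive_interval (a := t₀) (b := t₁) (f := f)
    (μ := volume) (by rw [uIcc_of_le ht]; exact h.integrableOn)
  rwa [uIcc_of_le ht] at this

theorem integrable_apply (h : IsPrimitiveOn t₀ t₁ x f) (i : Fin n) :
    IntegrableOn (fun t => f t i) (Icc t₀ t₁) :=
  (ContinuousLinearMap.proj (R := ℝ) (φ := fun _ : Fin n => ℝ) i).integrable_comp h.integrableOn

theorem apply_eq (h : IsPrimitiveOn t₀ t₁ x f) (i : Fin n) :
    ∀ t ∈ Icc t₀ t₁, x t i = x t₀ i + ∫ s in t₀..t, f s i := by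
  intro t ht
  have h1 : IntervalIntegrable f volume t₀ t :=
    (intervalIntegrable_iff_integrableOn_Icc_of_le ht.1).2
      (h.integrableOn.mono_set (Icc_subset_Icc_right ht.2))
  have h2 := (ContinuousLinearMap.proj (R := ℝ) (φ := fun _ : Fin n => ℝ) i).intervalIntegral_comp_comm h1
  simp only [ContinuousLinearMap.proj_apply] at h2
  rw [h2, ← Pi.add_apply, ← h.integral_eq t ht]

theorem mulVec (h : IsPrimitiveOn t₀ t₁ x f) (M : Matrix (Fin n) (Fin n) ℝ) :
    IsPrimitiveOn t₀ t₁ (fun t => M *ᵥ x t) (fun t => M *ᵥ f t) := by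
  let L : (Fin n → ℝ) →L[ℝ] (Fin n → ℝ) := LinearMap.toContinuousLinearMap M.mulVecLin
  refine ⟨L.integrable_comp h.integrableOn, fun t ht => ?_⟩
  have h1 : IntervalIntegrable f volume t₀ t :=
    (intervalIntegrable_iff_integrableOn_Icc_of_le ht.1).2
      (h.integrableOn.mono_set (Icc_subset_Icc_right ht.2))
  have h2 := L.intervalIntegral_comp_comm h1
  change ∫ s in t₀..t, M *ᵥ f s = M *ᵥ _ at h2
  rw [h2, ← Matrix.mulVec_add, ← h.integral_eq t ht]

theorem of_hasDerivAt (hx : ∀ t, HasDerivAt x (f t) t) (hf : Continuous f) :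
    IsPrimitiveOn t₀ t₁ x f := by
  refine ⟨hf.continuousOn.integrableOn_Icc, fun t _ => ?_⟩
  rw [intervalIntegral.integral_eq_sub_of_hasDerivAt (fun s _ => hx s) (hf.intervalIntegrable _ _),
    add_sub_cancel]

theorem integrableOn_dotProduct (hx : IsPrimitiveOn t₀ t₁ x f) (hq : IsPrimitiveOn t₀ t₁ q g)
    (ht : t₀ ≤ t₁) : IntegrableOn (fun t => f t ⬝ᵥ q t + x t ⬝ᵥ g t) (Icc t₀ t₁) := by
  have key : ∀ {y y' z z' : ℝ → Fin n → ℝ}, IsPrimitiveOn t₀ t₁ y y' → IsPrimitiveOn t₀ t₁ z z' →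
      IntegrableOn (fun t => y t ⬝ᵥ z' t) (Icc t₀ t₁) := by
    intro y y' z z' hy hz
    refine integrable_finsetSum _ fun i _ => ?_
    exact (hz.integrable_apply i).continuousOn_mul
      ((continuous_apply i).comp_continuousOn (hy.continuousOn ht)) isCompact_Icc
  refine Integrable.add ?_ (key hx hq)
  simp_rw [dotProduct_comm (f _)]
  exact key hq hx

/-- Integration by parts. -/
theorem integral_dotProduct (hx : IsPrimitiveOn t₀ t₁ x f) (hq : IsPrimitiveOn t₀ t₁ q g)
    (ht : t₀ ≤ t₁) :
    ∫ t in t₀..t₁, (f t ⬝ᵥ q t + x t ⬝ᵥ g t) = x t₁ ⬝ᵥ q t₁ - x t₀ ⬝ᵥ q t₀ := by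
  have hI : ∀ {y y' : ℝ → Fin n → ℝ}, IsPrimitiveOn t₀ t₁ y y' → ∀ i,
      IntervalIntegrable (fun t => y' t i) volume t₀ t₁ := fun hy i =>
    (intervalIntegrable_iff_integrableOn_Icc_of_le ht).2 (hy.integrable_apply i)
  have hC : ∀ {y y' : ℝ → Fin n → ℝ}, IsPrimitiveOn t₀ t₁ y y' → ∀ i,
      ContinuousOn (fun t => y t i) (uIcc t₀ t₁) := fun hy i => by
    rw [uIcc_of_le ht]
    exact (continuous_apply i).comp_continuousOn (hy.continuousOn ht)
  simp only [dotProduct, ← Finset.sum_add_distrib, ← Finset.sum_sub_distrib]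
  rw [intervalIntegral.integral_finsetSum]
  · refine Finset.sum_congr rfl fun i _ => ?_
    exact integral_mul_add_mul_eq_sub ht (hI hx i) (hI hq i) (hx.apply_eq i) (hq.apply_eq i)
  · intro i _
    exact ((hI hx i).mul_continuousOn (hC hq i)).add ((hI hq i).continuousOn_mul (hC hx i))

end IsPrimitiveOn

theorem memLp_mulVec {k l : ℕ} {μ : Measure ℝ} {w : ℝ → Fin k → ℝ} (hw : MemLp w 2 μ)
    (M : Matrix (Fin l) (Fin k) ℝ) : MemLp (fun t => M *ᵥ w t) 2 μ :=
  (LinearMap.toContinuousLinearMap M.mulVecLin).comp_memLp' hw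

theorem integrable_dotProduct {k : ℕ} {μ : Measure ℝ} {w z : ℝ → Fin k → ℝ} (hw : MemLp w 2 μ)
    (hz : MemLp z 2 μ) : Integrable (fun t => w t ⬝ᵥ z t) μ := by
  refine integrable_finsetSum _ fun i _ => ?_
  have hp : ∀ {w : ℝ → Fin k → ℝ}, MemLp w 2 μ → MemLp (fun t => w t i) 2 μ := fun hw =>
    (ContinuousLinearMap.proj (R := ℝ) (φ := fun _ : Fin k => ℝ) i).comp_memLp' hw
  exact (hp hw).integrable_mul (hp hz)

theorem memLp_of_continuousOn {k : ℕ} {t₀ t₁ : ℝ} {x : ℝ → Fin k → ℝ}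
    (hx : ContinuousOn x (Icc t₀ t₁)) : MemLp x 2 (volume.restrict (Icc t₀ t₁)) := by
  obtain ⟨C, hC⟩ := isCompact_Icc.exists_bound_of_continuousOn hx
  exact MemLp.of_bound (hx.aestronglyMeasurable measurableSet_Icc) C
    ((ae_restrict_iff' measurableSet_Icc).2 (Eventually.of_forall hC))

namespace IsTrajectory

variable {A : Matrix (Fin n) (Fin n) ℝ} {B : Matrix (Fin n) (Fin m) ℝ} {t₀ t₁ : ℝ}
  {x x' : ℝ → Fin n → ℝ} {u u' : ℝ → Fin m → ℝ}

theorem memLp_state (h : IsTrajectory A B t₀ t₁ x u) :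
    MemLp x 2 (volume.restrict (Icc t₀ t₁)) := memLp_of_continuousOn h.continuousOn

theorem isPrimitiveOn (h : IsTrajectory A B t₀ t₁ x u) :
    IsPrimitiveOn t₀ t₁ x (fun t => A *ᵥ x t + B *ᵥ u t) :=
  ⟨((memLp_mulVec h.memLp_state A).add (memLp_mulVec h.memLp B)).integrable (by norm_num),
    h.integral_eq⟩

theorem sub (h : IsTrajectory A B t₀ t₁ x u) (h' : IsTrajectory A B t₀ t₁ x' u') :
    IsTrajectory A B t₀ t₁ (fun t => x t - x' t) (fun t => u t - u' t) := by
  refine ⟨h.memLp.sub h'.memLp, h.continuousOn.sub h'.continuousOn, fun t ht => ?_⟩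
  have hI : ∀ {y : ℝ → Fin n → ℝ} {v : ℝ → Fin m → ℝ}, IsTrajectory A B t₀ t₁ y v →
      IntervalIntegrable (fun s => A *ᵥ y s + B *ᵥ v s) volume t₀ t := fun hy =>
    (intervalIntegrable_iff_integrableOn_Icc_of_le ht.1).2
      (hy.isPrimitiveOn.integrableOn.mono_set (Icc_subset_Icc_right ht.2))
  have : (fun s => A *ᵥ (x s - x' s) + B *ᵥ (u s - u' s)) =
      fun s => (A *ᵥ x s + B *ᵥ u s) - (A *ᵥ x' s + B *ᵥ u' s) := by
    ext1 s
    rw [Matrix.mulVec_sub, Matrix.mulVec_sub]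
    abel
  rw [this, intervalIntegral.integral_sub (hI h) (hI h'), h.integral_eq t ht, h'.integral_eq t ht]
  abel

theorem zero : IsTrajectory A B t₀ t₁ (fun _ => 0) (fun _ => 0) :=
  ⟨MemLp.zero, continuousOn_const, fun t _ => by simp⟩

theorem integrableOn_cost (h : IsTrajectory A B t₀ t₁ x u) (Q : Matrix (Fin n) (Fin n) ℝ)
    (S : Matrix (Fin n) (Fin m) ℝ) (R : Matrix (Fin m) (Fin m) ℝ) :
    IntegrableOn (fun t => x t ⬝ᵥ Q *ᵥ x t + 2 * (x t ⬝ᵥ S *ᵥ u t) + u t ⬝ᵥ R *ᵥ u t)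
      (Icc t₀ t₁) :=
  ((integrable_dotProduct h.memLp_state (memLp_mulVec h.memLp_state Q)).add
    ((integrable_dotProduct h.memLp_state (memLp_mulVec h.memLp S)).const_mul 2)).add
    (integrable_dotProduct h.memLp (memLp_mulVec h.memLp R))

/-- A trajectory of a linear feedback that starts at the origin stays there. -/
theorem eq_zero_of_feedback (h : IsTrajectory A B t₀ t₁ x u) (ht : t₀ ≤ t₁) (h0 : x t₀ = 0)
    {K : Matrix (Fin m) (Fin n) ℝ}
    (hu : ∀ᵐ t ∂volume.restrict (Icc t₀ t₁), u t + K *ᵥ x t = 0) :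
    ∀ t ∈ Icc t₀ t₁, x t = 0 := by
  set F := A - B * K with hF
  -- `x` is controlled on the interval only. Extending it by its end values makes the integrand
  -- continuous, so `y` is C¹ on ℝ and equals `x` on the interval; Grönwall then applies to `y`.
  let y : ℝ → Fin n → ℝ := fun t => ∫ s in t₀..t, F *ᵥ IccExtend ht (fun s : Icc t₀ t₁ => x s) s
  have hc : Continuous fun s => F *ᵥ IccExtend ht (fun s : Icc t₀ t₁ => x s) s := by
    have : Continuous (IccExtend ht (fun s : Icc t₀ t₁ => x s)) :=
      (continuousOn_iff_continuous_domRestrict.1 h.continuousOn).Icc_extend'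
    fun_prop
  have hext : ∀ s ∈ Icc t₀ t₁, IccExtend ht (fun s : Icc t₀ t₁ => x s) s = x s := fun s hs => by
    rw [IccExtend_of_mem ht _ hs]
  have hxy : ∀ t ∈ Icc t₀ t₁, x t = y t := by
    intro t htm
    rw [h.integral_eq t htm, h0, zero_add]
    refine intervalIntegral.integral_congr_ae ?_
    rw [ae_restrict_iff' measurableSet_Icc] at hu
    filter_upwards [hu] with s hs hsm
    rw [uIoc_of_le htm.1] at hsm
    have hs' : s ∈ Icc t₀ t₁ := ⟨hsm.1.le, hsm.2.trans htm.2⟩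
    rw [hext s hs', eq_neg_of_add_eq_zero_left (hs hs'), hF, Matrix.sub_mulVec,
      ← Matrix.mulVec_mulVec, Matrix.mulVec_neg, sub_eq_add_neg]
  have hy : ∀ t, HasDerivAt y (F *ᵥ IccExtend ht (fun s : Icc t₀ t₁ => x s) t) t := fun t =>
    intervalIntegral.integral_hasDerivAt_right (hc.intervalIntegrable _ _)
      (hc.stronglyMeasurableAtFilter _ _) hc.continuousAt
  let L : (Fin n → ℝ) →L[ℝ] (Fin n → ℝ) := LinearMap.toContinuousLinearMap F.mulVecLin
  have hz := eq_zero_of_abs_deriv_le_mul_abs_self_of_eq_zero_right (f := y)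
    (f' := fun t => F *ᵥ IccExtend ht (fun s : Icc t₀ t₁ => x s) t) (K := ‖L‖) (a := t₀) (b := t₁)
    (fun t _ => (hy t).continuousAt.continuousWithinAt) (fun t _ => (hy t).hasDerivWithinAt)
    (by simp [y]) (fun t htm => by
      rw [hext t (Ico_subset_Icc_self htm), hxy t (Ico_subset_Icc_self htm)]
      exact L.le_opNorm _)
  intro t htm
  rw [hxy t htm, hz t htm]

end IsTrajectory

variable {A : Matrix (Fin n) (Fin n) ℝ} {B : Matrix (Fin n) (Fin m) ℝ}
  {Q : Matrix (Fin n) (Fin n) ℝ} {S : Matrix (Fin n) (Fin m) ℝ} {R : Matrix (Fin m) (Fin m) ℝ}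
  {P : Matrix (Fin n) (Fin n) ℝ}

/-- The optimal feedback gain `R⁻¹ (Sᵀ + Bᵀ P)`. -/
noncomputable def gain (B : Matrix (Fin n) (Fin m) ℝ) (S : Matrix (Fin n) (Fin m) ℝ)
    (R : Matrix (Fin m) (Fin m) ℝ) (P : Matrix (Fin n) (Fin n) ℝ) : Matrix (Fin m) (Fin n) ℝ :=
  R⁻¹ * (Sᵀ + Bᵀ * P)

theorem closedLoop_eq (P : Matrix (Fin n) (Fin n) ℝ) :
    closedLoop A B S R P = A - B * gain B S R P := by
  rw [closedLoop, gain, Matrix.mul_assoc]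

theorem mul_gain (hR : R.PosDef) (P : Matrix (Fin n) (Fin n) ℝ) :
    R * gain B S R P = Sᵀ + Bᵀ * P := by
  rw [gain, ← Matrix.mul_assoc,
    Matrix.mul_nonsing_inv _ ((Matrix.isUnit_iff_isUnit_det _).1 hR.isUnit), Matrix.one_mul]

theorem dotProduct_mulVec_comm {k l : ℕ} (M : Matrix (Fin k) (Fin l) ℝ) (a : Fin k → ℝ)
    (b : Fin l → ℝ) : a ⬝ᵥ M *ᵥ b = b ⬝ᵥ Mᵀ *ᵥ a := by
  rw [Matrix.dotProduct_mulVec, ← Matrix.mulVec_transpose, dotProduct_comm]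

/-- Completion of the square. -/
theorem IsRiccatiSolution.complete_square (hR : R.PosDef) (h : IsRiccatiSolution A B Q S R P)
    (x : Fin n → ℝ) (u : Fin m → ℝ) :
    x ⬝ᵥ Q *ᵥ x + 2 * (x ⬝ᵥ S *ᵥ u) + u ⬝ᵥ R *ᵥ u =
      (u + gain B S R P *ᵥ x) ⬝ᵥ R *ᵥ (u + gain B S R P *ᵥ x) -
        ((A *ᵥ x + B *ᵥ u) ⬝ᵥ P *ᵥ x + x ⬝ᵥ P *ᵥ (A *ᵥ x + B *ᵥ u)) := by
  have hP : Pᵀ = P := h.symm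
  have hRt := transpose_eq_of_posDef hR
  have hRK := mul_gain (B := B) (S := S) hR P
  set K := gain B S R P with hK
  have e1 : x ⬝ᵥ Q *ᵥ x = (K *ᵥ x) ⬝ᵥ R *ᵥ (K *ᵥ x) - 2 * (x ⬝ᵥ P *ᵥ (A *ᵥ x)) := by
    -- The Riccati equation, solved for `Q`.
    have h1 : Q = (S + P * B) * K - P * A - Aᵀ * P := by
      rw [← sub_eq_zero, ← h.riccati, hK, gain]
      simp only [← Matrix.mul_assoc]
      abel
    have h2 : (K *ᵥ x) ⬝ᵥ R *ᵥ (K *ᵥ x) = x ⬝ᵥ ((S + P * B) * K) *ᵥ x := by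
      rw [Matrix.mulVec_mulVec, hRK, dotProduct_mulVec_comm, Matrix.transpose_add,
        Matrix.transpose_mul, Matrix.transpose_transpose, Matrix.transpose_transpose, hP,
        Matrix.mulVec_mulVec]
    have h3 : x ⬝ᵥ (Aᵀ * P) *ᵥ x = x ⬝ᵥ (P * A) *ᵥ x := by
      rw [dotProduct_mulVec_comm, Matrix.transpose_mul, Matrix.transpose_transpose, hP]
    rw [h2, Matrix.mulVec_mulVec]
    nth_rw 1 [h1]
    rw [Matrix.sub_mulVec, Matrix.sub_mulVec, dotProduct_sub, dotProduct_sub, h3]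
    ring
  have e2 : u ⬝ᵥ R *ᵥ (K *ᵥ x) = x ⬝ᵥ S *ᵥ u + x ⬝ᵥ P *ᵥ (B *ᵥ u) := by
    rw [Matrix.mulVec_mulVec, hRK, dotProduct_mulVec_comm, Matrix.transpose_add,
      Matrix.transpose_mul, Matrix.transpose_transpose, Matrix.transpose_transpose, hP,
      Matrix.add_mulVec, dotProduct_add, Matrix.mulVec_mulVec]
  have e3 : (K *ᵥ x) ⬝ᵥ R *ᵥ u = u ⬝ᵥ R *ᵥ (K *ᵥ x) := by
    rw [dotProduct_mulVec_comm, hRt]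
  have e4 : (A *ᵥ x + B *ᵥ u) ⬝ᵥ P *ᵥ x = x ⬝ᵥ P *ᵥ (A *ᵥ x + B *ᵥ u) := by
    rw [dotProduct_mulVec_comm, hP]
  rw [e1, e4]
  simp only [Matrix.mulVec_add, dotProduct_add, add_dotProduct]
  rw [e3, e2]
  ring

theorem IsTrajectory.memLp_add_mulVec {t₀ t₁ : ℝ} {x : ℝ → Fin n → ℝ} {u : ℝ → Fin m → ℝ}
    (h : IsTrajectory A B t₀ t₁ x u) (K : Matrix (Fin m) (Fin n) ℝ) :
    MemLp (fun t => u t + K *ᵥ x t) 2 (volume.restrict (Icc t₀ t₁)) :=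
  h.memLp.add (memLp_mulVec h.memLp_state K)

/-- The cost of a loop at the origin is the integral of a square. -/
theorem IsTrajectory.cost_eq_of_endpoints_eq_zero {t₀ t₁ : ℝ} {x : ℝ → Fin n → ℝ}
    {u : ℝ → Fin m → ℝ} (ht : t₀ ≤ t₁) (hR : R.PosDef) (hP : IsRiccatiSolution A B Q S R P)
    (h : IsTrajectory A B t₀ t₁ x u) (h0 : x t₀ = 0) (h1 : x t₁ = 0) :
    cost Q S R t₀ t₁ x u = ∫ t in t₀..t₁,
      (u t + gain B S R P *ᵥ x t) ⬝ᵥ R *ᵥ (u t + gain B S R P *ᵥ x t) := by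
  -- The term subtracted in `complete_square` is the derivative of xᵀPx, whose integral over a loop
  -- at the origin vanishes.
  have hI := h.isPrimitiveOn.integral_dotProduct (h.isPrimitiveOn.mulVec P) ht
  have hII := h.isPrimitiveOn.integrableOn_dotProduct (h.isPrimitiveOn.mulVec P) ht
  rw [h0, h1, zero_dotProduct, sub_self] at hI
  have hs := integrable_dotProduct (h.memLp_add_mulVec (gain B S R P))
    (memLp_mulVec (h.memLp_add_mulVec (gain B S R P)) R)
  rw [cost]
  simp_rw [hP.complete_square hR]
  rw [intervalIntegral.integral_sub
    ((intervalIntegrable_iff_integrableOn_Icc_of_le ht).2 hs)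
    ((intervalIntegrable_iff_integrableOn_Icc_of_le ht).2 hII), hI, sub_zero]

theorem IsTrajectory.cost_nonneg_of_endpoints_eq_zero {t₀ t₁ : ℝ} {x : ℝ → Fin n → ℝ}
    {u : ℝ → Fin m → ℝ} (ht : t₀ ≤ t₁) (hR : R.PosDef) (hP : IsRiccatiSolution A B Q S R P)
    (h : IsTrajectory A B t₀ t₁ x u) (h0 : x t₀ = 0) (h1 : x t₁ = 0) :
    0 ≤ cost Q S R t₀ t₁ x u := by
  rw [h.cost_eq_of_endpoints_eq_zero ht hR hP h0 h1]
  refine intervalIntegral.integral_nonneg ht fun t _ => ?_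
  simpa using hR.posSemidef.dotProduct_mulVec_nonneg (u t + gain B S R P *ᵥ x t)

/-- A loop at the origin of nonpositive cost is constant. -/
theorem IsTrajectory.eq_zero_of_cost_nonpos {t₀ t₁ : ℝ} {x : ℝ → Fin n → ℝ}
    {u : ℝ → Fin m → ℝ} (ht : t₀ ≤ t₁) (hR : R.PosDef) (hP : IsRiccatiSolution A B Q S R P)
    (h : IsTrajectory A B t₀ t₁ x u) (h0 : x t₀ = 0) (h1 : x t₁ = 0)
    (hc : cost Q S R t₀ t₁ x u ≤ 0) : ∀ t ∈ Icc t₀ t₁, x t = 0 := by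
  have hs := integrable_dotProduct (h.memLp_add_mulVec (gain B S R P))
    (memLp_mulVec (h.memLp_add_mulVec (gain B S R P)) R)
  have hc0 := le_antisymm hc (h.cost_nonneg_of_endpoints_eq_zero ht hR hP h0 h1)
  rw [h.cost_eq_of_endpoints_eq_zero ht hR hP h0 h1, intervalIntegral.integral_of_le ht,
    ← integral_Icc_eq_integral_Ioc, integral_eq_zero_iff_of_nonneg (fun t => by
      simpa using hR.posSemidef.dotProduct_mulVec_nonneg (u t + gain B S R P *ᵥ x t)) hs] at hc0
  -- A vanishing integral of the square forces u = -K x almost everywhere, since R is positive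
  -- definite.
  refine h.eq_zero_of_feedback ht h0 (K := gain B S R P) ?_
  filter_upwards [hc0] with t htt
  by_contra hne
  have := hR.dotProduct_mulVec_pos hne
  rw [star_trivial] at this
  exact this.ne' htt

/-! ### Extremals and comparison of costs -/

/-- `x`, driven by `u`, is an extremal with adjoint state `q`. -/
structure IsExtremal (A : Matrix (Fin n) (Fin n) ℝ) (B : Matrix (Fin n) (Fin m) ℝ)
    (Q : Matrix (Fin n) (Fin n) ℝ) (S : Matrix (Fin n) (Fin m) ℝ) (R : Matrix (Fin m) (Fin m) ℝ)
    (x : ℝ → Fin n → ℝ) (u : ℝ → Fin m → ℝ) (q : ℝ → Fin n → ℝ) : Prop where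
  continuous : Continuous u
  hasDerivAt : ∀ t, HasDerivAt x (A *ᵥ x t + B *ᵥ u t) t
  hasDerivAt_adjoint : ∀ t, HasDerivAt q (-(Q *ᵥ x t + S *ᵥ u t) - Aᵀ *ᵥ q t) t
  stationary : ∀ t, Sᵀ *ᵥ x t + R *ᵥ u t + Bᵀ *ᵥ q t = 0

namespace IsExtremal

variable {t₀ t₁ : ℝ} {x x' q q' : ℝ → Fin n → ℝ} {u u' : ℝ → Fin m → ℝ}

theorem add (h : IsExtremal A B Q S R x u q) (h' : IsExtremal A B Q S R x' u' q') :
    IsExtremal A B Q S R (fun t => x t + x' t) (fun t => u t + u' t) (fun t => q t + q' t) := by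
  refine ⟨h.continuous.add h'.continuous, fun t => ?_, fun t => ?_, fun t => ?_⟩
  · refine ((h.hasDerivAt t).add (h'.hasDerivAt t)).congr_deriv ?_
    simp only [Matrix.mulVec_add]
    abel
  · refine ((h.hasDerivAt_adjoint t).add (h'.hasDerivAt_adjoint t)).congr_deriv ?_
    simp only [Matrix.mulVec_add]
    abel
  · rw [← add_zero (0 : Fin m → ℝ)]
    nth_rw 1 [← h.stationary t]
    rw [← h'.stationary t]
    simp only [Matrix.mulVec_add]
    abel

theorem continuous_state (h : IsExtremal A B Q S R x u q) : Continuous x :=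
  continuous_iff_continuousAt.2 fun t => (h.hasDerivAt t).continuousAt

theorem continuous_adjoint (h : IsExtremal A B Q S R x u q) : Continuous q :=
  continuous_iff_continuousAt.2 fun t => (h.hasDerivAt_adjoint t).continuousAt

theorem isTrajectory (h : IsExtremal A B Q S R x u q) : IsTrajectory A B t₀ t₁ x u := by
  have hx := h.continuous_state
  have hu := h.continuous
  exact ⟨memLp_of_continuousOn hu.continuousOn, hx.continuousOn,
    (IsPrimitiveOn.of_hasDerivAt h.hasDerivAt (by fun_prop)).integral_eq⟩

theorem isPrimitiveOn_adjoint (h : IsExtremal A B Q S R x u q) :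
    IsPrimitiveOn t₀ t₁ q (fun t => -(Q *ᵥ x t + S *ᵥ u t) - Aᵀ *ᵥ q t) := by
  have hx := h.continuous_state
  have hu := h.continuous
  have hq := h.continuous_adjoint
  exact IsPrimitiveOn.of_hasDerivAt h.hasDerivAt_adjoint (by fun_prop)

/-- The cost of a competitor exceeds the one of an extremal by the cost of the difference. -/
theorem cost_eq_add_cost_sub (ht : t₀ ≤ t₁) (hQ : Q.IsSymm) (hR : R.PosDef)
    (h : IsExtremal A B Q S R x u q) (h' : IsTrajectory A B t₀ t₁ x' u') (h0 : x' t₀ = x t₀)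
    (h1 : x' t₁ = x t₁) :
    cost Q S R t₀ t₁ x' u' = cost Q S R t₀ t₁ x u +
      cost Q S R t₀ t₁ (fun t => x' t - x t) (fun t => u' t - u t) := by
  have hT : IsTrajectory A B t₀ t₁ x u := h.isTrajectory
  have hD := h'.sub hT
  have hq : IsPrimitiveOn t₀ t₁ q _ := h.isPrimitiveOn_adjoint
  have hI := hD.isPrimitiveOn.integral_dotProduct hq ht
  have hII := hD.isPrimitiveOn.integrableOn_dotProduct hq ht
  rw [h0, h1, sub_self, sub_self, zero_dotProduct, zero_dotProduct, sub_self] at hI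
  have hi : ∀ {φ : ℝ → ℝ}, IntegrableOn φ (Icc t₀ t₁) → IntervalIntegrable φ volume t₀ t₁ :=
    fun hφ => (intervalIntegrable_iff_integrableOn_Icc_of_le ht).2 hφ
  simp only [cost]
  rw [← intervalIntegral.integral_add (hi (hT.integrableOn_cost Q S R))
    (hi (hD.integrableOn_cost Q S R)), ← sub_eq_zero, ← intervalIntegral.integral_sub
    (hi (h'.integrableOn_cost Q S R))
    ((hi (hT.integrableOn_cost Q S R)).add (hi (hD.integrableOn_cost Q S R)))]
  -- The first variation vanishes: with δ = x' - x, stationarity and the adjoint equation turn the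
  -- cross terms into -2 times the derivative of δ ⬝ᵥ q, and δ vanishes at both ends.
  rw [← mul_zero (-2 : ℝ), ← hI, ← intervalIntegral.integral_const_mul]
  refine intervalIntegral.integral_congr fun t _ => ?_
  have hst := eq_neg_of_add_eq_zero_right (h.stationary t)
  have e0 : (B *ᵥ (u' t - u t)) ⬝ᵥ q t =
      -((u' t - u t) ⬝ᵥ Sᵀ *ᵥ x t + (u' t - u t) ⬝ᵥ R *ᵥ u t) := by
    rw [dotProduct_comm, dotProduct_mulVec_comm, hst, dotProduct_neg, dotProduct_add]
  have e1 : (A *ᵥ (x' t - x t)) ⬝ᵥ q t = (x' t - x t) ⬝ᵥ Aᵀ *ᵥ q t := by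
    rw [dotProduct_comm, dotProduct_mulVec_comm]
  simp only [add_dotProduct, e0, e1, dotProduct_sub, dotProduct_neg, dotProduct_add]
  have e2 : x t ⬝ᵥ Q *ᵥ x' t = x' t ⬝ᵥ Q *ᵥ x t := by rw [dotProduct_mulVec_comm, hQ.eq]
  have e3 : u t ⬝ᵥ R *ᵥ u' t = u' t ⬝ᵥ R *ᵥ u t := by
    rw [dotProduct_mulVec_comm, transpose_eq_of_posDef hR]
  have e4 : ∀ v : Fin m → ℝ, v ⬝ᵥ Sᵀ *ᵥ x t = x t ⬝ᵥ S *ᵥ v := fun v => by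
    rw [dotProduct_mulVec_comm, Matrix.transpose_transpose]
  simp only [e4, Matrix.mulVec_sub, dotProduct_sub, sub_dotProduct, e2, e3]
  ring

theorem cost_le (ht : t₀ ≤ t₁) (hQ : Q.IsSymm) (hR : R.PosDef)
    (hP : IsRiccatiSolution A B Q S R P)
    (h : IsExtremal A B Q S R x u q) (h' : IsTrajectory A B t₀ t₁ x' u') (h0 : x' t₀ = x t₀)
    (h1 : x' t₁ = x t₁) : cost Q S R t₀ t₁ x u ≤ cost Q S R t₀ t₁ x' u' := by
  rw [h.cost_eq_add_cost_sub ht hQ hR h' h0 h1]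
  exact le_add_of_nonneg_right ((h'.sub h.isTrajectory).cost_nonneg_of_endpoints_eq_zero ht hR hP
    (sub_eq_zero.2 h0) (sub_eq_zero.2 h1))

theorem eqOn_of_cost_le (ht : t₀ ≤ t₁) (hQ : Q.IsSymm) (hR : R.PosDef)
    (hP : IsRiccatiSolution A B Q S R P)
    (h : IsExtremal A B Q S R x u q) (h' : IsTrajectory A B t₀ t₁ x' u') (h0 : x' t₀ = x t₀)
    (h1 : x' t₁ = x t₁) (hc : cost Q S R t₀ t₁ x' u' ≤ cost Q S R t₀ t₁ x u) :
    EqOn x' x (Icc t₀ t₁) := by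
  rw [h.cost_eq_add_cost_sub ht hQ hR h' h0 h1, add_le_iff_nonpos_right] at hc
  exact fun t htm => sub_eq_zero.1 ((h'.sub h.isTrajectory).eq_zero_of_cost_nonpos ht hR hP
    (sub_eq_zero.2 h0) (sub_eq_zero.2 h1) hc t htm)

/-- The zero trajectory is a competitor of cost 0, so the extremal is a loop of nonpositive cost. -/
theorem eq_zero_of_endpoints_eq_zero (ht : t₀ ≤ t₁) (hQ : Q.IsSymm) (hR : R.PosDef)
    (hP : IsRiccatiSolution A B Q S R P)
    (h : IsExtremal A B Q S R x u q) (h0 : x t₀ = 0) (h1 : x t₁ = 0) :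
    ∀ t ∈ Icc t₀ t₁, x t = 0 := by
  have hT : IsTrajectory A B t₀ t₁ x u := h.isTrajectory
  have hc := h.cost_le ht hQ hR hP IsTrajectory.zero h0.symm h1.symm
  exact hT.eq_zero_of_cost_nonpos ht hR hP h0 h1 (hc.trans_eq (by simp [cost]))

end IsExtremal

/-! ### Exponential extremals and the two-point problem -/

section Exp

open NormedSpace

theorem hasDerivAt_exp_smul_mulVec (M : Matrix (Fin n) (Fin n) ℝ) (y : Fin n → ℝ) (t : ℝ) :
    HasDerivAt (fun t : ℝ => exp (t • M) *ᵥ y) (M *ᵥ (exp (t • M) *ᵥ y)) t := by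
  have h1 : HasDerivAt (fun t : ℝ => exp (t • M)) (M * exp (t • M)) t := by
    let _ : NormedRing (Matrix (Fin n) (Fin n) ℝ) := Matrix.linftyOpNormedRing
    let _ : NormedAlgebra ℝ (Matrix (Fin n) (Fin n) ℝ) := Matrix.linftyOpNormedAlgebra
    exact hasDerivAt_exp_smul_const' M t
  have h2 : ∀ i j, HasDerivAt (fun t : ℝ => exp (t • M) i j) ((M * exp (t • M)) i j) t :=
    fun i j => hasDerivAt_pi.1 (hasDerivAt_pi.1 h1 i) j
  rw [Matrix.mulVec_mulVec, hasDerivAt_pi]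
  intro i
  simp only [Matrix.mulVec, dotProduct]
  exact HasDerivAt.fun_sum fun j _ => (h2 i j).mul_const (y j)

/-- With q = P x, stationarity is the definition of the gain, and the adjoint equation is the
Riccati equation rewritten as P A_P = -(Q - S K) - Aᵀ P, where A_P is the closed loop and K the
gain. -/
theorem IsRiccatiSolution.isExtremal (hR : R.PosDef) (hP : IsRiccatiSolution A B Q S R P)
    (y : Fin n → ℝ) :
    IsExtremal A B Q S R (fun t => exp (t • closedLoop A B S R P) *ᵥ y)
      (fun t => -(gain B S R P *ᵥ (exp (t • closedLoop A B S R P) *ᵥ y)))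
      (fun t => P *ᵥ (exp (t • closedLoop A B S R P) *ᵥ y)) := by
  have hd := hasDerivAt_exp_smul_mulVec (closedLoop A B S R P) y
  have hc : Continuous fun t : ℝ => exp (t • closedLoop A B S R P) *ᵥ y :=
    continuous_iff_continuousAt.2 fun t => (hd t).continuousAt
  refine ⟨by fun_prop, fun t => ?_, fun t => ?_, fun t => ?_⟩
  · convert hd t using 1
    rw [closedLoop_eq, Matrix.sub_mulVec, Matrix.mulVec_neg, ← sub_eq_add_neg,
      Matrix.mulVec_mulVec _ B]
  · have h1 := (LinearMap.toContinuousLinearMap P.mulVecLin).hasFDerivAt.comp_hasDerivAt t (hd t)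
    refine h1.congr_deriv ?_
    change P *ᵥ _ = _
    generalize exp (t • closedLoop A B S R P) *ᵥ y = w
    have h2 : P * closedLoop A B S R P = -(Q - S * gain B S R P) - Aᵀ * P := by
      rw [← sub_eq_zero, ← hP.riccati, closedLoop_eq, gain]
      simp only [Matrix.mul_sub, Matrix.add_mul, Matrix.mul_assoc]
      abel
    rw [Matrix.mulVec_mulVec w P, h2]
    simp only [Matrix.sub_mulVec, Matrix.neg_mulVec, Matrix.mulVec_neg, Matrix.mulVec_mulVec]
    abel
  · generalize exp (t • closedLoop A B S R P) *ᵥ y = w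
    rw [Matrix.mulVec_neg, Matrix.mulVec_mulVec w R, mul_gain hR, Matrix.add_mulVec,
      Matrix.mulVec_mulVec w Bᵀ]
    abel

/-- Differentiating k times at an interior time inserts F ^ k and H ^ k, which reduces the claim to
the cancellation of orbits. The invertible exponentials are removed last. -/
theorem eq_zero_of_exp_mulVec_add_eq_zero {F H : Matrix (Fin n) (Fin n) ℝ} (hF : IsStable F)
    (hH : IsAntiStable H) {t₀ t₁ : ℝ} (ht : t₀ < t₁) {y z : Fin n → ℝ}
    (h : ∀ t ∈ Icc t₀ t₁, exp (t • F) *ᵥ y + exp (t • H) *ᵥ z = 0) : y = 0 ∧ z = 0 := by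
  have hcomm : ∀ (M : Matrix (Fin n) (Fin n) ℝ) (t : ℝ) (k : ℕ) (w : Fin n → ℝ),
      exp (t • M) *ᵥ ((M ^ k) *ᵥ w) = (M ^ k) *ᵥ (exp (t • M) *ᵥ w) := by
    intro M t k w
    have hc : Commute (exp (t • M)) (M ^ k) :=
      (((Commute.refl M).smul_left t).exp_left).pow_right k
    rw [Matrix.mulVec_mulVec, Matrix.mulVec_mulVec, hc.eq]
  have key : ∀ k : ℕ, ∀ t ∈ Ioo t₀ t₁,
      (F ^ k) *ᵥ (exp (t • F) *ᵥ y) + (H ^ k) *ᵥ (exp (t • H) *ᵥ z) = 0 := by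
    intro k
    induction k with
    | zero => intro t htm; simpa using h t (Ioo_subset_Icc_self htm)
    | succ k ih =>
      intro t htm
      have h1 := (hasDerivAt_exp_smul_mulVec F ((F ^ k) *ᵥ y) t).add
        (hasDerivAt_exp_smul_mulVec H ((H ^ k) *ᵥ z) t)
      have h2 : HasDerivAt (fun _ : ℝ => (0 : Fin n → ℝ)) 0 t := hasDerivAt_const t 0
      have h3 := h2.congr_of_eventuallyEq (f₁ := (fun t : ℝ => exp (t • F) *ᵥ ((F ^ k) *ᵥ y)) +
        fun t : ℝ => exp (t • H) *ᵥ ((H ^ k) *ᵥ z)) (by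
          filter_upwards [Ioo_mem_nhds htm.1 htm.2] with s hs
          rw [Pi.add_apply, hcomm, hcomm, ih s hs])
      have h4 := h1.unique h3
      rwa [hcomm, hcomm, Matrix.mulVec_mulVec _ F, Matrix.mulVec_mulVec _ H, ← pow_succ',
        ← pow_succ'] at h4
  obtain ⟨s, hs⟩ := nonempty_Ioo.2 ht
  obtain ⟨h1, h2⟩ := eq_zero_of_pow_mulVec_add_eq_zero hF hH fun k => key k s hs
  have hu : ∀ (M : Matrix (Fin n) (Fin n) ℝ) (w : Fin n → ℝ), exp (s • M) *ᵥ w = 0 → w = 0 := by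
    intro M w hw
    have := Matrix.isUnit_exp (s • M)
    rw [Matrix.isUnit_iff_isUnit_det] at this
    rw [← Matrix.one_mulVec w, ← Matrix.nonsing_inv_mul _ this, ← Matrix.mulVec_mulVec, hw,
      Matrix.mulVec_zero]
  exact ⟨hu F y h1, hu H z h2⟩

theorem describesSynthesis_of_isSynthesisPair {Ap Am : Matrix (Fin n) (Fin n) ℝ}
    (hC : AdmissibleCost A B Q S R) (h : IsSynthesisPair A B Q S R Ap Am) :
    DescribesSynthesis A B Q S R Ap Am := by
  obtain ⟨⟨P, hP, rfl, hs⟩, P', hP', rfl, ha⟩ := h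
  intro t₀ t₁ ht x₀ x₁
  set F := closedLoop A B S R P
  set H := closedLoop A B S R P'
  have hQ := hC.symm
  have hR := hC.posDef
  have hext := fun y z : Fin n → ℝ => (hP.isExtremal hR y).add (hP'.isExtremal hR z)
  -- The endpoint map of the family of extremals. Source and target have equal dimension, so
  -- injectivity yields an extremal for any end points and also the uniqueness of (y₊, y₋).
  let E : (Fin n → ℝ) × (Fin n → ℝ) →ₗ[ℝ] (Fin n → ℝ) × (Fin n → ℝ) :=
    ((exp (t₀ • F)).mulVecLin.coprod (exp (t₀ • H)).mulVecLin).prod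
      ((exp (t₁ • F)).mulVecLin.coprod (exp (t₁ • H)).mulVecLin)
  have hE : ∀ y, E y = (exp (t₀ • F) *ᵥ y.1 + exp (t₀ • H) *ᵥ y.2,
      exp (t₁ • F) *ᵥ y.1 + exp (t₁ • H) *ᵥ y.2) := fun y => rfl
  have hinj : Function.Injective E := by
    rw [injective_iff_map_eq_zero]
    intro y hy
    rw [hE, Prod.mk_eq_zero] at hy
    have h1 := (hext y.1 y.2).eq_zero_of_endpoints_eq_zero ht.le hQ hR hP hy.1 hy.2
    obtain ⟨h2, h3⟩ := eq_zero_of_exp_mulVec_add_eq_zero hs ha ht h1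
    exact Prod.ext h2 h3
  obtain ⟨y, hy⟩ := (LinearMap.injective_iff_surjective.1 hinj) (x₀, x₁)
  rw [hE, Prod.mk.injEq] at hy
  have hmin : ∀ x, IsMinimizing A B Q S R t₀ t₁ x → x t₀ = x₀ → x t₁ = x₁ →
      EqOn x (fun t => exp (t • F) *ᵥ y.1 + exp (t • H) *ᵥ y.2) (Icc t₀ t₁) := by
    rintro x ⟨u, hx, hle⟩ h0 h1
    have h0' := h0.trans hy.1.symm
    have h1' := h1.trans hy.2.symm
    exact (hext y.1 y.2).eqOn_of_cost_le ht.le hQ hR hP hx h0' h1'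
      (hle _ _ (hext y.1 y.2).isTrajectory h0'.symm h1'.symm)
  refine ⟨⟨_, ⟨_, (hext y.1 y.2).isTrajectory, fun x' u' h' h0 h1 =>
    (hext y.1 y.2).cost_le ht.le hQ hR hP h' h0 h1⟩, hy⟩, fun x x' hx h0 h1 hx' h0' h1' =>
    (hmin x hx h0 h1).trans (hmin x' hx' h0' h1').symm, fun x hx h0 h1 =>
    ⟨y, fun t htm => hmin x hx h0 h1 htm, fun z hz => hinj ?_⟩⟩
  rw [hE, hE, hy.1, hy.2, ← hz t₀ (left_mem_Icc.2 ht.le), ← hz t₁ (right_mem_Icc.2 ht.le), h0, h1]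

end Exp

end AutonomousLQ

/-- Characterization of the set `𝒥` of pairs `(A₊, A₋)` corresponding to optimal syntheses of
autonomous linear-quadratic problems. The first conjunct says that a pair attached to a problem
does describe its optimal synthesis, the second one is the characterization of `𝒥`. -/
theorem mainTheorem12 {n m : ℕ} (A : Matrix (Fin n) (Fin n) ℝ) (B : Matrix (Fin n) (Fin m) ℝ)
    (hAB : AutonomousLQ.AdmissibleDynamics A B) :
    (∀ (Q : Matrix (Fin n) (Fin n) ℝ) (S : Matrix (Fin n) (Fin m) ℝ)
        (R : Matrix (Fin m) (Fin m) ℝ) (Ap Am : Matrix (Fin n) (Fin n) ℝ),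
        AutonomousLQ.AdmissibleCost A B Q S R →
        AutonomousLQ.IsSynthesisPair A B Q S R Ap Am →
        AutonomousLQ.DescribesSynthesis A B Q S R Ap Am) ∧
    AutonomousLQ.synthesisPairs A B =
      {p : Matrix (Fin n) (Fin n) ℝ × Matrix (Fin n) (Fin n) ℝ |
        ∃ Kp Km : Matrix (Fin m) (Fin n) ℝ, p.1 = A - B * Kp ∧ p.2 = A - B * Km ∧
          ∃ Δ : Matrix (Fin n) (Fin n) ℝ, Δ.PosDef ∧
            p.1 = -(Δ⁻¹ * p.2ᵀ * Δ) ∧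
            AutonomousLQ.IsStable p.1 ∧
            (-((Bᵀ * B)⁻¹ * Bᵀ * (p.1 * Δ⁻¹ + Δ⁻¹ * p.1ᵀ) * B * (Bᵀ * B)⁻¹)).PosDef} := by
  refine ⟨fun Q S R Ap Am hC h => AutonomousLQ.describesSynthesis_of_isSynthesisPair hC h,
    Set.ext fun p => ⟨fun hp => AutonomousLQ.exists_gains_of_mem_synthesisPairs hAB.rank_eq hp, ?_⟩⟩
  rintro ⟨Kp, Km, h1, h2, Δ, hΔ, h3, hs, hN⟩
  exact AutonomousLQ.mem_synthesisPairs_of_exists_gains hAB.rank_eq h1 h2 hΔ h3 hs hN
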